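/- Let $b\in C^\infty(\mathbb R)$ be real-valued with $t\,b(t)>0$ for all $t\neq 0$, put $B(t)=\int_0^t b(s)\,ds$, and let $M=\partial_t+i\,b(t)\,\partial_x$ on $\mathbb R^2$ with coordinates $(t,x)$. Let $f\in C_0^\infty(\mathbb R^2)$ be complex-valued, let $\widehat f(s,\xi)=\frac1{2\pi}\int_{-\infty}^{+\infty}e^{-iy\xi}f(s,y)\,dy$ be its Fourier transform in the second variable, and define, for $x\in\mathbb R$, $$Kf(x)=\int_0^{+\infty}\Big(\int_{-\infty}^{+\infty}e^{i(x+iB(s))\xi}\,\widehat f(s,\xi)\,ds\Big)d\xi .$$ Then there exist an open neighbourhood $\Omega$ of the origin of $\mathbb R^2$ and a distribution $u\in\mathcal D'(\Omega)$ with $Mu=f$ in $\mathcal D'(\Omega)$ if and only if $Kf$ is real analytic at $0$ (that is, $Kf$ is given by a convergent power series in a neighbourhood of $0$). Moreover, if $Kf$ is real analytic at $0$, then there exist an open neighbourhood $\Omega$ of the origin and a $C^\infty$ function $u$ on $\Omega$ with $Mu=f$ in $\Omega$. -/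

import Mathlib

open scoped Distributions ContDiff LineDeriv

noncomputable section

namespace Mizohata

open MeasureTheory TopologicalSpace Set

/-- The product `a φ` of a smooth real function `a` on the plane and a test function `φ`. -/
def mulTest {Ω : Opens (ℝ × ℝ)} (a : ℝ × ℝ → ℝ) (ha : ContDiff ℝ ∞ a) (φ : 𝓓(Ω, ℝ)) :
    𝓓(Ω, ℝ) where
  toFun p := a p * φ p
  contDiff' := ha.mul φ.contDiff
  hasCompactSupport' := φ.hasCompactSupport.mul_left
  tsupport_subset' := (tsupport_mul_subset_right (f := a) (g := φ)).trans φ.tsupport_subset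

/-- The distribution `M u = ∂_t u + i b(t) ∂_x u`, evaluated at a test function `φ`. Points of the
plane are pairs `(t, x)`, `∂_{v}` is the derivative of distributions in the direction `v`, and the
product of a distribution `T` with the smooth function `b(t)` is `φ ↦ T (b φ)`. -/
def opM (b : ℝ → ℝ) (hb : ContDiff ℝ ∞ b) {Ω : Opens (ℝ × ℝ)} (u : 𝓓'(Ω, ℂ))
    (φ : 𝓓(Ω, ℝ)) : ℂ :=
  (∂_{((1, 0) : ℝ × ℝ)} u) φ +
    Complex.I * (∂_{((0, 1) : ℝ × ℝ)} u) (mulTest (fun p => b p.1) (hb.comp contDiff_fst) φ)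

/-- `M u = f` in the space of distributions on `Ω`. -/
def IsSolution (b : ℝ → ℝ) (hb : ContDiff ℝ ∞ b) (f : ℝ × ℝ → ℂ) {Ω : Opens (ℝ × ℝ)}
    (u : 𝓓'(Ω, ℂ)) : Prop :=
  ∀ φ : 𝓓(Ω, ℝ), opM b hb u φ = ∫ p : ℝ × ℝ, (φ p : ℂ) * f p

/-- The distribution `u` on `Ω` is (given by) a smooth function on `Ω`. -/
def IsSmooth {Ω : Opens (ℝ × ℝ)} (u : 𝓓'(Ω, ℂ)) : Prop :=
  ∃ w : ℝ × ℝ → ℂ, ContDiffOn ℝ ∞ w Ω ∧ ∀ φ : 𝓓(Ω, ℝ), u φ = ∫ p : ℝ × ℝ, (φ p : ℂ) * w p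

/-- The primitive `B(t) = ∫_0^t b(s) ds`. -/
def primB (b : ℝ → ℝ) (t : ℝ) : ℝ := ∫ s in (0 : ℝ)..t, b s

/-- The partial Fourier transform of `f(s, x)` with respect to `x`, normalized so that
`f(s, x) = ∫ e^{i x ξ} f̂(s, ξ) dξ`. -/
def fourierX (f : ℝ × ℝ → ℂ) (s ξ : ℝ) : ℂ :=
  (1 / (2 * Real.pi) : ℂ) * ∫ y : ℝ, Complex.exp (-(Complex.I * y * ξ)) * f (s, y)

/-- `K f (x) = ∫_0^∞ ∫_ℝ e^{i (x + i B(s)) ξ} f̂(s, ξ) ds dξ`. -/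
def Kf (b : ℝ → ℝ) (f : ℝ × ℝ → ℂ) (x : ℝ) : ℂ :=
  ∫ ξ in Ioi (0 : ℝ), ∫ s : ℝ,
    Complex.exp (Complex.I * (x + Complex.I * (primB b s : ℂ)) * ξ) * fourierX f s ξ

end Mizohata

end

/-! The function Z = x - iB(t) satisfies MZ = 0, and since B ≥ 0 vanishes only at 0, Z takes values
in the closed lower half-plane and vanishes only at the origin. Both directions rest on this.

Necessity. For Im w > 0 the kernel 1/(Z - w) is smooth and annihilated by M. Let χ be a cutoff equal
to 1 near the origin. If Mu = f, then ∫ χf/(Z - w) = -⟨u, Mχ/(Z - w)⟩, because the transpose of M is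
-M. Both Mχ and (1 - χ)f vanish near the only zero of Z, so expanding 1/(Z - w) in powers of w shows
that ∫ f/(Z - w) agrees for Im w > 0 with a function holomorphic near 0
(`exists_analyticAt_cauchyTransform`). By Fubini this integral is, up to the factor 2πi, the
extension of Kf to the upper half-plane (`halfKf_eq_cauchyTransform`); letting w tend to the real
axis gives the analyticity of Kf.

Sufficiency. Fourier transform in x turns the equation into v' = b ξ v + f̂, solved by integrating
exp((B(t) - B(s))ξ) f̂(s, ξ) from a starting time. For ξ < 0 this stays bounded when started at t =
0. For ξ > 0 one must integrate towards t = 0, from -T on the left and from T on the right, and the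
two pieces then differ on t = 0 by exactly Kf (`wave_sub_wave_eq_Kf`). If H is a holomorphic
extension of Kf, adding H(Z), a solution of the homogeneous equation, on the right removes the jump.
The glued function is smooth: its x-derivative is the same construction for (∂_x f, H'), and the
equation gives its t-derivative, so one can induct on the order
(`IsExtension.contDiffOn_solution_nat`). -/

noncomputable section

namespace Mizohata

open MeasureTheory TopologicalSpace Set Filter Topology

/-! ### Sign and monotonicity of the primitive B. -/

section Primitive

variable {b : ℝ → ℝ}

lemma hasDerivAt_primB (hb : Continuous b) (t : ℝ) : HasDerivAt (primB b) (b t) t :=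
  intervalIntegral.integral_hasDerivAt_right (hb.intervalIntegrable _ _)
    (hb.stronglyMeasurableAtFilter _ _) hb.continuousAt

lemma contDiff_primB (hb : ContDiff ℝ ∞ b) : ContDiff ℝ ∞ (primB b) := by
  have h : deriv (primB b) = b := funext fun t => (hasDerivAt_primB hb.continuous t).deriv
  rw [contDiff_infty_iff_deriv, h]
  exact ⟨fun t => (hasDerivAt_primB hb.continuous t).differentiableAt, hb⟩

lemma continuous_primB (hb : Continuous b) : Continuous (primB b) :=
  continuous_iff_continuousAt.2 fun t => (hasDerivAt_primB hb t).continuousAt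

@[simp] lemma primB_zero : primB b 0 = 0 := by simp [primB]

lemma strictMonoOn_primB (hb : Continuous b) (hpos : ∀ t : ℝ, t ≠ 0 → 0 < t * b t) :
    StrictMonoOn (primB b) (Ici 0) := by
  refine strictMonoOn_of_deriv_pos (convex_Ici 0) (continuous_primB hb).continuousOn fun t ht => ?_
  rw [interior_Ici, mem_Ioi] at ht
  rw [(hasDerivAt_primB hb t).deriv]
  exact pos_of_mul_pos_right (hpos t ht.ne') ht.le

lemma strictAntiOn_primB (hb : Continuous b) (hpos : ∀ t : ℝ, t ≠ 0 → 0 < t * b t) :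
    StrictAntiOn (primB b) (Iic 0) := by
  refine strictAntiOn_of_deriv_neg (convex_Iic 0) (continuous_primB hb).continuousOn fun t ht => ?_
  rw [interior_Iic, mem_Iio] at ht
  rw [(hasDerivAt_primB hb t).deriv]
  have := hpos t ht.ne
  by_contra! h
  exact absurd this (not_lt.2 (mul_nonpos_of_nonpos_of_nonneg ht.le h))

lemma primB_pos (hb : Continuous b) (hpos : ∀ t : ℝ, t ≠ 0 → 0 < t * b t) {t : ℝ} (ht : t ≠ 0) :
    0 < primB b t := by
  rw [← primB_zero (b := b)]
  rcases lt_or_gt_of_ne ht with h | h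
  · exact strictAntiOn_primB hb hpos h.le (mem_Iic.2 le_rfl) h
  · exact strictMonoOn_primB hb hpos (mem_Ici.2 le_rfl) h.le h

lemma primB_nonneg (hb : Continuous b) (hpos : ∀ t : ℝ, t ≠ 0 → 0 < t * b t) (t : ℝ) :
    0 ≤ primB b t := by
  rcases eq_or_ne t 0 with rfl | h
  · simp
  · exact (primB_pos hb hpos h).le

end Primitive

/-! ### Partial Fourier transform: decay and inversion. -/

section PartialFourier

/-- The derivative of `f(t, x)` with respect to `x`. -/
def dx (f : ℝ × ℝ → ℂ) (p : ℝ × ℝ) : ℂ := fderiv ℝ f p (0, 1)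

variable {f : ℝ × ℝ → ℂ}

lemma contDiff_dx (hf : ContDiff ℝ ∞ f) : ContDiff ℝ ∞ (dx f) :=
  (hf.fderiv_right (m := ∞) (by simp)).clm_apply contDiff_const

lemma tsupport_dx_subset : tsupport (dx f) ⊆ tsupport f := by
  refine (closure_mono ?_).trans (tsupport_fderiv_subset ℝ (f := f))
  intro p hp h
  exact hp (by simp [dx, h])

lemma hasCompactSupport_dx (hfc : HasCompactSupport f) : HasCompactSupport (dx f) :=
  hfc.of_isClosed_subset (isClosed_tsupport _) tsupport_dx_subset

lemma hasDerivAt_dx (hf : ContDiff ℝ ∞ f) (t x : ℝ) :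
    HasDerivAt (fun y => f (t, y)) (dx f (t, x)) x := by
  have h1 : HasFDerivAt f (fderiv ℝ f (t, x)) (t, x) :=
    (hf.differentiable (by simp)).differentiableAt.hasFDerivAt
  exact h1.comp_hasDerivAt x ((hasDerivAt_const x t).prodMk (hasDerivAt_id x))

lemma hasCompactSupport_slice (hfc : HasCompactSupport f) (t : ℝ) :
    HasCompactSupport fun y => f (t, y) := by
  refine HasCompactSupport.of_support_subset_isCompact (hfc.isCompact.image continuous_snd) ?_
  intro y hy
  exact ⟨(t, y), subset_tsupport _ hy, rfl⟩

lemma continuous_fourierX (hf : Continuous f) (hfc : HasCompactSupport f) :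
    Continuous fun p : ℝ × ℝ => fourierX f p.1 p.2 := by
  refine continuous_const.mul ?_
  have hk : IsCompact (Prod.snd '' tsupport f) := hfc.isCompact.image continuous_snd
  have := continuous_parametric_integral_of_continuous (μ := volume)
    (f := fun (p : ℝ × ℝ) (y : ℝ) => Complex.exp (-(Complex.I * y * p.2)) * f (p.1, y))
    (by unfold Function.uncurry; fun_prop) hk
  refine this.congr fun p => setIntegral_eq_integral_of_forall_compl_eq_zero fun y hy => ?_
  have : f (p.1, y) = 0 := by
    by_contra h
    exact hy ⟨(p.1, y), subset_tsupport _ h, rfl⟩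
  simp [this]

lemma fourierX_eq_zero {T : ℝ} (hT : ∀ p ∈ tsupport f, |p.1| < T) {s : ℝ} (hs : T ≤ |s|) (ξ : ℝ) :
    fourierX f s ξ = 0 := by
  have : ∀ y, f (s, y) = 0 := fun y => by
    by_contra h
    exact absurd (hT _ (subset_tsupport _ h)) (not_lt.2 hs)
  simp [fourierX, this]

lemma fourierX_dx (hf : ContDiff ℝ ∞ f) (hfc : HasCompactSupport f) (s ξ : ℝ) :
    fourierX (dx f) s ξ = Complex.I * ξ * fourierX f s ξ := by
  have h := integral_mul_deriv_eq_deriv_mul_of_integrable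
    (u := fun y : ℝ => Complex.exp (-(Complex.I * y * ξ)))
    (u' := fun y : ℝ => -(Complex.I * ξ) * Complex.exp (-(Complex.I * y * ξ)))
    (v := fun y => f (s, y)) (v' := fun y => dx f (s, y))
    (fun y _ => by
      have : HasDerivAt (fun y : ℝ => -(Complex.I * y * ξ)) (-(Complex.I * 1 * ξ)) y :=
        (((Complex.ofRealCLM.hasDerivAt (x := y)).const_mul Complex.I).mul_const (ξ : ℂ)).neg
      convert! this.cexp using 1
      ring)
    (fun y _ => hasDerivAt_dx hf s y)
    (Continuous.integrable_of_hasCompactSupport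
      (by have := (contDiff_dx hf).continuous; fun_prop)
      ((hasCompactSupport_slice (hasCompactSupport_dx hfc) s).mul_left))
    (Continuous.integrable_of_hasCompactSupport
      (by have := hf.continuous; fun_prop) ((hasCompactSupport_slice hfc s).mul_left))
    (Continuous.integrable_of_hasCompactSupport
      (by have := hf.continuous; fun_prop) ((hasCompactSupport_slice hfc s).mul_left))
  unfold fourierX
  rw [h]
  simp_rw [mul_assoc]
  rw [integral_const_mul]
  ring

lemma exists_bound_fourierX_aux (hf : Continuous f) (hfc : HasCompactSupport f) :
    ∃ C, ∀ s ξ, ‖fourierX f s ξ‖ ≤ C := by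
  obtain ⟨M, hM⟩ := hf.bounded_above_of_compact_support hfc
  have hk : IsCompact (Prod.snd '' tsupport f) := hfc.isCompact.image continuous_snd
  refine ⟨‖(1 / (2 * Real.pi) : ℂ)‖ * (M * volume.real (Prod.snd '' tsupport f)), fun s ξ => ?_⟩
  rw [fourierX, norm_mul]
  gcongr
  rw [← setIntegral_eq_integral_of_forall_compl_eq_zero (s := Prod.snd '' tsupport f)]
  · refine norm_setIntegral_le_of_norm_le_const hk.measure_lt_top fun y _ => ?_
    have : ‖Complex.exp (-(Complex.I * y * ξ))‖ = 1 := by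
      rw [Complex.norm_exp]; simp
    rw [norm_mul, this, one_mul]
    exact hM _
  · intro y hy
    have : f (s, y) = 0 := by
      by_contra h
      exact hy ⟨(s, y), subset_tsupport _ h, rfl⟩
    simp [this]

/-- Two integrations by parts bound ξ² f̂. This integrable majorant suffices throughout, since
differentiating in x only replaces f by ∂_x f, to which the bound applies again. -/
lemma exists_bound_fourierX (hf : ContDiff ℝ ∞ f) (hfc : HasCompactSupport f) :
    ∃ C, 0 ≤ C ∧ ∀ s ξ, ‖fourierX f s ξ‖ ≤ C * (1 + ξ ^ 2)⁻¹ := by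
  obtain ⟨C, hC⟩ := exists_bound_fourierX_aux hf.continuous hfc
  obtain ⟨D, hD⟩ := exists_bound_fourierX_aux (contDiff_dx (contDiff_dx hf)).continuous
    (hasCompactSupport_dx (hasCompactSupport_dx hfc))
  have hC0 : 0 ≤ C := (norm_nonneg _).trans (hC 0 0)
  have hD0 : 0 ≤ D := (norm_nonneg _).trans (hD 0 0)
  refine ⟨C + D, by positivity, fun s ξ => ?_⟩
  rw [← div_eq_mul_inv, le_div_iff₀ (by positivity)]
  have h := hD s ξ
  rw [fourierX_dx (contDiff_dx hf) (hasCompactSupport_dx hfc), fourierX_dx hf hfc] at h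
  simp only [norm_mul, Complex.norm_I, one_mul, Complex.norm_real, Real.norm_eq_abs] at h
  have : |ξ| * (|ξ| * ‖fourierX f s ξ‖) = ‖fourierX f s ξ‖ * ξ ^ 2 := by
    rw [← sq_abs]; ring
  rw [this] at h
  linarith [hC s ξ]

lemma integrable_bound (C : ℝ) : Integrable fun ξ : ℝ => C * (1 + ξ ^ 2)⁻¹ :=
  integrable_inv_one_add_sq.const_mul C

lemma fourierX_inversion (hf : ContDiff ℝ ∞ f) (hfc : HasCompactSupport f) (t x : ℝ) :
    ∫ ξ : ℝ, Complex.exp (Complex.I * x * ξ) * fourierX f t ξ = f (t, x) := by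
  set h : ℝ → ℂ := fun y => f (t, y)
  have hh : Continuous h := by have := hf.continuous; fun_prop
  -- Mathlib puts 2π in the exponent; the rescaling ξ ↦ 2πξ passes between the two normalizations.
  have hF : ∀ ξ, FourierTransform.fourier h ξ = 2 * Real.pi * fourierX f t (2 * Real.pi * ξ) := by
    intro ξ
    rw [Real.fourier_eq', fourierX, ← mul_assoc]
    rw [mul_one_div_cancel (by simp [Real.pi_ne_zero]), one_mul]
    refine integral_congr_ae (ae_of_all _ fun y => ?_)
    simp only [smul_eq_mul, h]
    congr 2
    simp
    ring
  obtain ⟨C, hC0, hC⟩ := exists_bound_fourierX hf hfc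
  have hint : Integrable (fun ξ => fourierX f t ξ) :=
    (integrable_bound C).mono' ((continuous_fourierX hf.continuous hfc).comp
      (by fun_prop : Continuous fun ξ : ℝ => (t, ξ))).aestronglyMeasurable
      (ae_of_all _ fun ξ => hC t ξ)
  have hFi : Integrable (FourierTransform.fourier h) := by
    have : FourierTransform.fourier h = fun ξ => 2 * Real.pi * fourierX f t (2 * Real.pi * ξ) :=
      funext hF
    rw [this]
    exact (hint.comp_mul_left' (by simp [Real.pi_ne_zero])).const_mul _
  have key := congrFun (hh.fourierInv_fourier_eq
    (hh.integrable_of_hasCompactSupport (hasCompactSupport_slice hfc t)) hFi) x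
  rw [Real.fourierInv_eq'] at key
  change _ = f (t, x) at key
  rw [← key]
  have := Measure.integral_comp_mul_left
    (fun ξ : ℝ => Complex.exp (Complex.I * x * ξ) * fourierX f t ξ) (2 * Real.pi)
  simp_rw [hF]
  have e : ∀ ξ : ℝ, Complex.exp (↑(2 * Real.pi * inner ℝ ξ x) * Complex.I) •
      (2 * Real.pi * fourierX f t (2 * Real.pi * ξ)) =
      (2 * Real.pi) * (Complex.exp (Complex.I * x * ↑(2 * Real.pi * ξ)) *
        fourierX f t (2 * Real.pi * ξ)) := by
    intro ξ
    rw [smul_eq_mul]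
    have : (↑(2 * Real.pi * inner ℝ ξ x) * Complex.I : ℂ) =
      Complex.I * x * ↑(2 * Real.pi * ξ) := by
      simp; ring
    rw [this]; ring
  simp_rw [e]
  rw [integral_const_mul, this]
  have hp : (0 : ℝ) < 2 * Real.pi := by positivity
  rw [abs_of_pos (inv_pos.2 hp), Complex.real_smul, ← mul_assoc]
  push_cast
  rw [mul_inv_cancel₀ (by simp [Real.pi_ne_zero]), one_mul]

end PartialFourier

/-! ### Analyticity from geometric remainder estimates. -/

section PowerSeries

lemma exists_analyticAt_hasSum {a : ℕ → ℂ} {A C : ℝ} (hA : 0 < A) (ha : ∀ n, ‖a n‖ ≤ C * A ^ n) :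
    ∃ G : ℂ → ℂ, AnalyticAt ℂ G 0 ∧ ∀ w : ℂ, A * ‖w‖ < 1 → HasSum (fun n => a n * w ^ n) (G w) := by
  set p : FormalMultilinearSeries ℂ ℂ ℂ := FormalMultilinearSeries.ofScalars ℂ a with hp
  have hr : ENNReal.ofReal A⁻¹ ≤ p.radius := by
    refine p.le_radius_of_bound C fun n => ?_
    rw [hp, FormalMultilinearSeries.ofScalars_norm, Real.coe_toNNReal _ (by positivity)]
    calc ‖a n‖ * A⁻¹ ^ n ≤ (C * A ^ n) * A⁻¹ ^ n := by gcongr; exact ha n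
      _ = C := by rw [mul_assoc, ← mul_pow, mul_inv_cancel₀ hA.ne', one_pow, mul_one]
  have hpos : 0 < p.radius := lt_of_lt_of_le (by simpa using hA) hr
  refine ⟨p.sum, (p.hasFPowerSeriesOnBall hpos).analyticAt, fun w hw => ?_⟩
  have := p.hasSum (x := w) ?_
  · simpa [hp, FormalMultilinearSeries.ofScalars_apply_eq, mul_comm] using this
  · refine Metric.eball_subset_eball hr ?_
    rw [Metric.mem_eball, edist_zero_right, ← ofReal_norm]
    refine (ENNReal.ofReal_lt_ofReal_iff (by positivity)).2 ?_
    rwa [← one_div, lt_div_iff₀' hA]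

/-- Only A must be uniform in w: for A‖w‖ < 1 the remainder tends to 0 at each fixed w, so D may
blow up as w approaches the boundary of W. -/
lemma exists_analyticAt_of_remainder {F : ℂ → ℂ} {W : Set ℂ} {a : ℕ → ℂ} {A C : ℝ} (hA : 0 < A)
    (ha : ∀ n, ‖a n‖ ≤ C * A ^ n)
    (h : ∀ w ∈ W, ∃ D, ∀ N : ℕ,
      ‖F w - ∑ n ∈ Finset.range N, a n * w ^ n‖ ≤ D * (A * ‖w‖) ^ N) :
    ∃ G : ℂ → ℂ, AnalyticAt ℂ G 0 ∧ ∀ᶠ w in 𝓝 0, w ∈ W → F w = G w := by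
  obtain ⟨G, hG, hs⟩ := exists_analyticAt_hasSum hA ha
  refine ⟨G, hG, ?_⟩
  have : ∀ᶠ w : ℂ in 𝓝 0, A * ‖w‖ < 1 :=
    (continuous_const.mul continuous_norm).continuousAt.eventually_lt_const (by simp)
  filter_upwards [this] with w hw hwW
  obtain ⟨D, hD⟩ := h w hwW
  have h0 : Tendsto (fun N : ℕ => D * (A * ‖w‖) ^ N) atTop (𝓝 0) := by
    simpa using (tendsto_pow_atTop_nhds_zero_of_lt_one (by positivity) hw).const_mul D
  have h1 := squeeze_zero_norm hD h0
  have h2 : Tendsto (fun N : ℕ => F w - ∑ n ∈ Finset.range N, a n * w ^ n) atTop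
      (𝓝 (F w - G w)) := tendsto_const_nhds.sub (hs w hw).tendsto_sum_nat
  exact sub_eq_zero.1 (tendsto_nhds_unique h2 h1)

end PowerSeries

/-! ### Complex test functions and finite order of distributions. -/

section Complexification

variable {Ω : Opens (ℝ × ℝ)}

/-- The extension of a distribution to complex-valued test functions. -/
def cext (u : 𝓓'(Ω, ℂ)) : 𝓓(Ω, ℂ) →ₗ[ℂ] ℂ where
  toFun φ := u (TestFunction.postcompCLM Complex.reCLM φ) +
    Complex.I * u (TestFunction.postcompCLM Complex.imCLM φ)
  map_add' φ ψ := by simp only [map_add]; ring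
  map_smul' c φ := by
    have h1 : TestFunction.postcompCLM Complex.reCLM (c • φ) =
        c.re • TestFunction.postcompCLM Complex.reCLM φ -
          c.im • TestFunction.postcompCLM Complex.imCLM φ := by
      ext p; simp
    have h2 : TestFunction.postcompCLM Complex.imCLM (c • φ) =
        c.re • TestFunction.postcompCLM Complex.imCLM φ +
          c.im • TestFunction.postcompCLM Complex.reCLM φ := by
      ext p; simp
    rw [h1, h2]
    simp only [map_add, map_sub, map_smul, Complex.real_smul, RingHom.id_apply, smul_eq_mul]
    conv_rhs => rw [← Complex.re_add_im c]
    linear_combination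
      (-(c.im : ℂ) * u (TestFunction.postcompCLM Complex.imCLM φ)) * Complex.I_sq

lemma cext_apply (u : 𝓓'(Ω, ℂ)) (φ : 𝓓(Ω, ℂ)) :
    cext u φ = u (TestFunction.postcompCLM Complex.reCLM φ) +
      Complex.I * u (TestFunction.postcompCLM Complex.imCLM φ) := rfl

lemma exists_order_bound (u : 𝓓'(Ω, ℂ)) {K : Set (ℝ × ℝ)} (hK : IsCompact K) (hKΩ : K ⊆ Ω) :
    ∃ (m : ℕ) (C : ℝ), 0 ≤ C ∧ ∀ φ : 𝓓(Ω, ℝ), tsupport φ ⊆ K → ∀ D, 0 ≤ D →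
      (∀ k ≤ m, ∀ x ∈ K, ‖iteratedFDeriv ℝ k φ x‖ ≤ D) → ‖u φ‖ ≤ C * D := by
  let K' : Compacts (ℝ × ℝ) := ⟨K, hK⟩
  let q : Seminorm ℝ 𝓓^{⊤}_{K'}(ℝ × ℝ, ℝ) := (normSeminorm ℝ ℂ).comp
    (u.toLinearMap ∘ₗ (TestFunction.ofSupportedInCLM ℝ (K := K') (Ω := Ω) hKΩ).toLinearMap)
  have hq : Continuous q :=
    continuous_norm.comp (u.continuous.comp (TestFunction.continuous_ofSupportedIn hKΩ))
  obtain ⟨s, C, -, hC⟩ := Seminorm.bound_of_continuous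
    (ContDiffMapSupportedIn.withSeminorms ℝ (ℝ × ℝ) ℝ ⊤ K') q hq
  -- The seminorms are indexed by the order of derivative, so the largest index in `s` is an order
  -- of the distribution on `K`.
  refine ⟨s.sup id, C, C.2, fun φ hφ D hD h => ?_⟩
  let φ' : 𝓓^{⊤}_{K'}(ℝ × ℝ, ℝ) := ContDiffMapSupportedIn.of_support_subset φ.contDiff
    ((subset_tsupport _).trans hφ)
  have e : u φ = u (TestFunction.ofSupportedIn (K := K') hKΩ φ') := rfl
  have h1 : ‖u φ‖ ≤ C * (s.sup (ContDiffMapSupportedIn.seminorm ℝ (ℝ × ℝ) ℝ ⊤ K')) φ' := hC φ'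
  refine h1.trans (mul_le_mul_of_nonneg_left ?_ C.2)
  refine Seminorm.finset_sup_apply_le hD fun i hi => ?_
  rw [ContDiffMapSupportedIn.seminorm_le_iff ℝ hD]
  intro _ x hx
  exact h i (Finset.le_sup (f := id) hi) x hx

lemma exists_order_bound_cext (u : 𝓓'(Ω, ℂ)) {K : Set (ℝ × ℝ)} (hK : IsCompact K) (hKΩ : K ⊆ Ω) :
    ∃ (m : ℕ) (C : ℝ), 0 ≤ C ∧ ∀ φ : 𝓓(Ω, ℂ), tsupport φ ⊆ K → ∀ D, 0 ≤ D →
      (∀ k ≤ m, ∀ x ∈ K, ‖iteratedFDeriv ℝ k φ x‖ ≤ D) → ‖cext u φ‖ ≤ C * D := by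
  obtain ⟨m, C, hC, h⟩ := exists_order_bound u hK hKΩ
  refine ⟨m, 2 * C, by positivity, fun φ hφ D hD hb => ?_⟩
  have aux : ∀ L : ℂ →L[ℝ] ℝ, ‖L‖ ≤ 1 → ‖u (TestFunction.postcompCLM L φ)‖ ≤ C * D := by
    intro L hL
    refine h _ ((tsupport_comp_subset (map_zero L) φ).trans hφ) D hD fun k hk x hx => ?_
    rw [TestFunction.postcompCLM_apply]
    refine (L.norm_iteratedFDeriv_comp_left φ.contDiff.contDiffAt (by exact_mod_cast le_top)).trans ?_
    calc _ ≤ 1 * D := by gcongr; exact hb k hk x hx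
      _ = D := one_mul _
  rw [cext_apply]
  refine (norm_add_le _ _).trans ?_
  rw [norm_mul, Complex.norm_I, one_mul]
  linarith [aux Complex.reCLM (by simp), aux Complex.imCLM (by simp)]

/-- The product of a complex test function with a smooth function. -/
def mulSmooth (ψ : 𝓓(Ω, ℂ)) (g : ℝ × ℝ → ℂ) (hg : ContDiff ℝ ∞ g) : 𝓓(Ω, ℂ) where
  toFun p := ψ p * g p
  contDiff' := ψ.contDiff.mul hg
  hasCompactSupport' := ψ.hasCompactSupport.mul_right
  tsupport_subset' := (tsupport_mul_subset_left (f := ψ) (g := g)).trans ψ.tsupport_subset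

@[simp] lemma mulSmooth_apply (ψ : 𝓓(Ω, ℂ)) (g : ℝ × ℝ → ℂ) (hg : ContDiff ℝ ∞ g) (p : ℝ × ℝ) :
    mulSmooth ψ g hg p = ψ p * g p := rfl

lemma exists_iteratedFDeriv_bound {g : ℝ × ℝ → ℂ} (hg : ContDiff ℝ ∞ g) {K : Set (ℝ × ℝ)}
    (hK : IsCompact K) (m : ℕ) :
    ∃ A, 0 < A ∧ ∀ k ≤ m, ∀ x ∈ K, ‖iteratedFDeriv ℝ k g x‖ ≤ A := by
  have h : ∀ k, ∃ B, ∀ x ∈ K, ‖iteratedFDeriv ℝ k g x‖ ≤ B := fun k =>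
    hK.exists_bound_of_continuousOn
      (hg.continuous_iteratedFDeriv (by exact_mod_cast le_top)).continuousOn
  choose B hB using h
  refine ⟨1 + ∑ k ∈ Finset.range (m + 1), |B k|, by positivity, fun k hk x hx => ?_⟩
  have := Finset.single_le_sum (f := fun k => |B k|) (fun i _ => abs_nonneg _)
    (Finset.mem_range.2 (Nat.lt_succ_of_le hk))
  linarith [hB k x hx, le_abs_self (B k)]

/-- With at most m derivatives, Leibniz makes each further factor g cost at most 2^m times a bound
for its derivatives, so the growth in n is only geometric, at a rate independent of F. -/
lemma iteratedFDeriv_mul_pow_bound {g : ℝ × ℝ → ℂ} (hg : ContDiff ℝ ∞ g) {K : Set (ℝ × ℝ)}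
    (hK : IsCompact K) (m : ℕ) :
    ∃ A, 0 < A ∧ ∀ (F : ℝ × ℝ → ℂ) (_ : ContDiff ℝ ∞ F) (D : ℝ),
      (∀ k ≤ m, ∀ x ∈ K, ‖iteratedFDeriv ℝ k F x‖ ≤ D) → ∀ n : ℕ,
      ∀ k ≤ m, ∀ x ∈ K, ‖iteratedFDeriv ℝ k (fun p => F p * g p ^ n) x‖ ≤ D * A ^ n := by
  obtain ⟨A', hA', hb⟩ := exists_iteratedFDeriv_bound hg hK m
  refine ⟨2 ^ m * A', by positivity, fun F hF D hD n => ?_⟩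
  induction n with
  | zero => simpa using hD
  | succ n ih =>
    intro k hk x hx
    have e : (fun p => F p * g p ^ (n + 1)) = fun p => (F p * g p ^ n) * g p := by
      ext p; ring
    have hD0 : 0 ≤ D := (norm_nonneg _).trans (hD 0 (Nat.zero_le _) x hx)
    rw [e]
    refine (norm_iteratedFDeriv_mul_le (hF.mul (hg.pow n)) hg x
      (n := k) (by exact_mod_cast le_top)).trans ?_
    calc _ ≤ ∑ i ∈ Finset.range (k + 1), (k.choose i : ℝ) * (D * (2 ^ m * A') ^ n) * A' := by
          refine Finset.sum_le_sum fun i hi => ?_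
          have hi' : i ≤ k := Nat.lt_succ_iff.1 (Finset.mem_range.1 hi)
          gcongr
          · exact ih i (hi'.trans hk) x hx
          · exact hb _ ((Nat.sub_le _ _).trans hk) x hx
      _ = 2 ^ k * ((D * (2 ^ m * A') ^ n) * A') := by
          simp_rw [mul_assoc]
          rw [← Finset.sum_mul, ← Nat.cast_sum, Nat.sum_range_choose]
          push_cast; ring
      _ ≤ 2 ^ m * ((D * (2 ^ m * A') ^ n) * A') := by
          gcongr
          norm_num
      _ = _ := by ring

end Complexification

/-! ### The first integral Z and the Cauchy kernel 1/(Z - w). -/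

section FirstIntegral

variable {b : ℝ → ℝ}

/-- The first integral `Z(t, x) = x - i B(t)` of the operator. -/
def firstIntegral (b : ℝ → ℝ) (p : ℝ × ℝ) : ℂ := p.2 - Complex.I * primB b p.1

lemma contDiff_firstIntegral (hb : ContDiff ℝ ∞ b) : ContDiff ℝ ∞ (firstIntegral b) :=
  (Complex.ofRealCLM.contDiff.comp contDiff_snd).sub
    (contDiff_const.mul (Complex.ofRealCLM.contDiff.comp ((contDiff_primB hb).comp contDiff_fst)))

@[simp] lemma firstIntegral_re (p : ℝ × ℝ) : (firstIntegral b p).re = p.2 := by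
  simp [firstIntegral]

@[simp] lemma firstIntegral_im (p : ℝ × ℝ) : (firstIntegral b p).im = -primB b p.1 := by
  simp [firstIntegral]

lemma hasFDerivAt_firstIntegral (hb : ContDiff ℝ ∞ b) (p : ℝ × ℝ) :
    ∃ L : ℝ × ℝ →L[ℝ] ℂ, HasFDerivAt (firstIntegral b) L p ∧
      L (1, 0) = -(Complex.I * b p.1) ∧ L (0, 1) = 1 := by
  have h1 : HasFDerivAt (fun p : ℝ × ℝ => (p.2 : ℂ))
      (Complex.ofRealCLM.comp (ContinuousLinearMap.snd ℝ ℝ ℝ)) p :=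
    Complex.ofRealCLM.hasFDerivAt.comp p hasFDerivAt_snd
  have h2 : HasFDerivAt (fun p : ℝ × ℝ => (primB b p.1 : ℂ)) _ p :=
    Complex.ofRealCLM.hasFDerivAt.comp p
      (((hasDerivAt_primB hb.continuous p.1).hasFDerivAt).comp p hasFDerivAt_fst)
  refine ⟨_, h1.sub (h2.const_mul Complex.I), ?_, ?_⟩ <;> simp

lemma firstIntegral_sub_ne_zero (hb : Continuous b) (hpos : ∀ t : ℝ, t ≠ 0 → 0 < t * b t)
    {w : ℂ} (hw : 0 < w.im) (p : ℝ × ℝ) : firstIntegral b p - w ≠ 0 := by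
  intro h
  have := congrArg Complex.im h
  simp only [Complex.sub_im, firstIntegral_im, Complex.zero_im] at this
  linarith [primB_nonneg hb hpos p.1]

lemma contDiff_cauchyKernel (hb : ContDiff ℝ ∞ b) (hpos : ∀ t : ℝ, t ≠ 0 → 0 < t * b t)
    {w : ℂ} (hw : 0 < w.im) : ContDiff ℝ ∞ fun p => (firstIntegral b p - w)⁻¹ :=
  ((contDiff_firstIntegral hb).sub contDiff_const).inv
    (firstIntegral_sub_ne_zero hb.continuous hpos hw)

/-- As Im Z ≤ 0, subtracting iκ with a bump κ ≥ 0 at the origin pushes Z further down and removes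
its only zero. Off the support of κ nothing changes, so the inverse of Z - iκ is a global smooth
substitute for 1/Z on K. -/
lemma exists_regularized_inv (hb : ContDiff ℝ ∞ b) (hpos : ∀ t : ℝ, t ≠ 0 → 0 < t * b t)
    {K : Set (ℝ × ℝ)} (hK : IsClosed K) (h0 : (0, 0) ∉ K) :
    ∃ g : ℝ × ℝ → ℂ, ContDiff ℝ ∞ g ∧ ∀ p ∈ K, firstIntegral b p * g p = 1 := by
  obtain ⟨r, hr, hrK⟩ := Metric.isOpen_iff.1 hK.isOpen_compl _ h0
  let κ : ContDiffBump ((0, 0) : ℝ × ℝ) := ⟨r / 2, r, by positivity, by linarith⟩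
  have hne : ∀ p, firstIntegral b p - Complex.I * κ p ≠ 0 := by
    intro p h
    have hre := congrArg Complex.re h
    have him := congrArg Complex.im h
    simp only [Complex.sub_re, firstIntegral_re, Complex.sub_im, firstIntegral_im,
      Complex.mul_re, Complex.mul_im, Complex.I_re, Complex.I_im, Complex.ofReal_re,
      Complex.ofReal_im, Complex.zero_re, Complex.zero_im] at hre him
    have hκ := κ.nonneg (x := p)
    have hB := primB_nonneg hb.continuous hpos p.1
    have h1 : p.1 = 0 := by
      by_contra h1
      linarith [primB_pos hb.continuous hpos h1]
    have h2 : p.2 = 0 := by linarith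
    have h3 : p = (0, 0) := Prod.ext h1 h2
    have h4 : 0 < κ p := by
      rw [h3]
      exact κ.pos_of_mem_ball (Metric.mem_ball_self κ.rOut_pos)
    linarith
  refine ⟨fun p => (firstIntegral b p - Complex.I * κ p)⁻¹,
    ((contDiff_firstIntegral hb).sub (contDiff_const.mul
      (Complex.ofRealCLM.contDiff.comp κ.contDiff))).inv hne, fun p hp => ?_⟩
  have : κ p = 0 := by
    apply κ.zero_of_le_dist
    by_contra! h
    exact hrK (Metric.mem_ball.2 h) hp
  have h := hne p
  simp only [this, Complex.ofReal_zero, mul_zero, sub_zero] at h ⊢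
  exact mul_inv_cancel₀ h

/-- On the support of ψ, 1/(Z - w) is a geometric series in w/Z. Finite order of u bounds the
coefficients and the remainder geometrically, so the pairing needs no differentiation in w. -/
lemma exists_analyticAt_cext_cauchy (hb : ContDiff ℝ ∞ b) (hpos : ∀ t : ℝ, t ≠ 0 → 0 < t * b t)
    {Ω : Opens (ℝ × ℝ)} (u : 𝓓'(Ω, ℂ)) (ψ : 𝓓(Ω, ℂ)) (h0 : (0, 0) ∉ tsupport ψ) :
    ∃ G : ℂ → ℂ, AnalyticAt ℂ G 0 ∧ ∀ᶠ w in 𝓝 (0 : ℂ), ∀ hw : 0 < w.im,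
      cext u (mulSmooth ψ _ (contDiff_cauchyKernel hb hpos hw)) = G w := by
  classical
  obtain ⟨g, hg, hZg⟩ := exists_regularized_inv hb hpos (isClosed_tsupport ψ) h0
  have hK : IsCompact (tsupport ψ) := ψ.hasCompactSupport
  obtain ⟨m, C, hC, hu⟩ := exists_order_bound_cext u hK ψ.tsupport_subset
  obtain ⟨A, hA, hA'⟩ := iteratedFDeriv_mul_pow_bound hg hK m
  have bound : ∀ (h : ℝ × ℝ → ℂ) (hh : ContDiff ℝ ∞ h), ∃ D, 0 ≤ D ∧ ∀ n : ℕ,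
      ‖cext u (mulSmooth ψ (fun p => h p * g p ^ n) (hh.mul (hg.pow n)))‖ ≤ D * A ^ n := by
    intro h hh
    obtain ⟨D, hD, hD'⟩ := exists_iteratedFDeriv_bound (ψ.contDiff.mul hh) hK m
    refine ⟨C * D, by positivity, fun n => ?_⟩
    rw [mul_assoc]
    refine hu _ (tsupport_mul_subset_left (f := ψ)) _ (by positivity) fun k hk x hx => ?_
    have := hA' _ (ψ.contDiff.mul hh) D hD' n k hk x hx
    convert! this using 3
    ext p
    simp [mul_assoc]
  -- The coefficient is ⟨u, ψ g^(n+1)⟩, written as h g^n with h = g so that `bound` covers both it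
  -- and the remainder, where h = 1/(Z - w).
  set a : ℕ → ℂ := fun n => cext u (mulSmooth ψ (fun p => g p * g p ^ n) (hg.mul (hg.pow n)))
  obtain ⟨D₀, hD₀, ha⟩ := bound g hg
  -- The value 0 outside the upper half-plane is arbitrary; F is compared with G only where Im w >
  -- 0.
  let F : ℂ → ℂ := fun w => if hw : 0 < w.im then
    cext u (mulSmooth ψ _ (contDiff_cauchyKernel hb hpos hw)) else 0
  obtain ⟨G, hG, hFG⟩ := exists_analyticAt_of_remainder (F := F) (W := {w | 0 < w.im}) hA ha (by
    intro w hw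
    obtain ⟨D, hD, hR⟩ := bound _ (contDiff_cauchyKernel hb hpos hw)
    refine ⟨D, fun N => ?_⟩
    have key : F w - ∑ n ∈ Finset.range N, a n * w ^ n = w ^ N *
        cext u (mulSmooth ψ (fun p => (firstIntegral b p - w)⁻¹ * g p ^ N)
          ((contDiff_cauchyKernel hb hpos hw).mul (hg.pow N))) := by
      induction N with
      | zero =>
        have : F w = cext u (mulSmooth ψ _ (contDiff_cauchyKernel hb hpos hw)) := dif_pos hw
        simp only [Finset.range_zero, Finset.sum_empty, sub_zero, pow_zero, one_mul, this]
        congr 1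
        ext p
        simp
      | succ N ih =>
        rw [Finset.sum_range_succ, ← sub_sub, ih]
        -- The identity 1/(Z - w) = g + w g/(Z - w), valid on the support of ψ where Zg = 1, peels
        -- off one term of the series.
        have e : mulSmooth ψ (fun p => (firstIntegral b p - w)⁻¹ * g p ^ N)
            ((contDiff_cauchyKernel hb hpos hw).mul (hg.pow N)) =
            mulSmooth ψ (fun p => g p * g p ^ N) (hg.mul (hg.pow N)) +
            w • mulSmooth ψ (fun p => (firstIntegral b p - w)⁻¹ * g p ^ (N + 1))
              ((contDiff_cauchyKernel hb hpos hw).mul (hg.pow (N + 1))) := by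
          ext p
          simp only [mulSmooth_apply, FunLike.coe_add, Pi.add_apply, FunLike.coe_smul,
            Pi.smul_apply, smul_eq_mul]
          by_cases hp : p ∈ tsupport ψ
          · have h1 := hZg p hp
            have h2 := firstIntegral_sub_ne_zero hb.continuous hpos hw p
            have h3 : (firstIntegral b p - w)⁻¹ = g p + w * ((firstIntegral b p - w)⁻¹ * g p) := by
              field_simp
              linear_combination -h1
            rw [pow_succ]
            linear_combination (ψ p * g p ^ N) * h3
          · simp [image_eq_zero_of_notMem_tsupport hp]
        rw [e, map_add, map_smul, smul_eq_mul]
        ring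
    rw [key, norm_mul, norm_pow]
    calc ‖w‖ ^ N * _ ≤ ‖w‖ ^ N * (D * A ^ N) := by gcongr; exact hR N
      _ = D * (A * ‖w‖) ^ N := by ring)
  refine ⟨G, hG, ?_⟩
  filter_upwards [hFG] with w hw him
  have : F w = cext u (mulSmooth ψ _ (contDiff_cauchyKernel hb hpos him)) := dif_pos him
  rw [← hw him, this]

end FirstIntegral

/-! ### Pairing a solution with complex test functions. -/

section Transpose

variable {b : ℝ → ℝ} {Ω : Opens (ℝ × ℝ)}

/-- The operator `M` acting on complex test functions. -/
def opTest (hb : ContDiff ℝ ∞ b) (φ : 𝓓(Ω, ℂ)) : 𝓓(Ω, ℂ) :=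
  ∂_{((1, 0) : ℝ × ℝ)} φ + Complex.I • mulSmooth (∂_{((0, 1) : ℝ × ℝ)} φ) (fun p => (b p.1 : ℂ))
    (Complex.ofRealCLM.contDiff.comp (hb.comp contDiff_fst))

lemma lineDeriv_testFunction_apply {F : Type*} [NormedAddCommGroup F] [NormedSpace ℝ F]
    (φ : 𝓓(Ω, F)) (v p : ℝ × ℝ) : (∂_{v} φ) p = fderiv ℝ φ p v := by
  rw [TestFunction.lineDerivOp_eq_lineDerivCLM (𝕜 := ℝ), TestFunction.lineDerivCLM_eq_fderivCLM]
  simp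

lemma opTest_apply (hb : ContDiff ℝ ∞ b) (φ : 𝓓(Ω, ℂ)) (p : ℝ × ℝ) :
    opTest hb φ p = fderiv ℝ φ p (1, 0) + Complex.I * b p.1 * fderiv ℝ φ p (0, 1) := by
  change (∂_{((1, 0) : ℝ × ℝ)} φ) p + Complex.I * ((∂_{((0, 1) : ℝ × ℝ)} φ) p * b p.1) = _
  rw [lineDeriv_testFunction_apply, lineDeriv_testFunction_apply]
  ring

lemma fderiv_postcomp (L : ℂ →L[ℝ] ℝ) (φ : 𝓓(Ω, ℂ)) (p v : ℝ × ℝ) :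
    fderiv ℝ (TestFunction.postcompCLM L φ) p v = L (fderiv ℝ φ p v) := by
  have h : HasFDerivAt φ (fderiv ℝ φ p) p :=
    (φ.contDiff.differentiable (by simp)).differentiableAt.hasFDerivAt
  rw [TestFunction.postcompCLM_apply, (L.hasFDerivAt.comp p h).fderiv]
  rfl

/-- Since b depends on t alone it commutes with ∂_x, so the transpose of M is -M with no
zeroth-order term. -/
lemma opM_eq (hb : ContDiff ℝ ∞ b) (u : 𝓓'(Ω, ℂ)) (φ : 𝓓(Ω, ℝ)) :
    opM b hb u φ = -(u (∂_{((1, 0) : ℝ × ℝ)} φ) +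
      Complex.I * u (mulTest (fun p => b p.1) (hb.comp contDiff_fst)
        (∂_{((0, 1) : ℝ × ℝ)} φ))) := by
  have e : ∂_{((0, 1) : ℝ × ℝ)} (mulTest (fun p => b p.1) (hb.comp contDiff_fst) φ) =
      mulTest (fun p => b p.1) (hb.comp contDiff_fst) (∂_{((0, 1) : ℝ × ℝ)} φ) := by
    ext p
    rw [lineDeriv_testFunction_apply]
    change fderiv ℝ ((fun p : ℝ × ℝ => b p.1) * ⇑φ) p (0, 1) = b p.1 * _
    rw [lineDeriv_testFunction_apply]
    have h : HasFDerivAt φ (fderiv ℝ φ p) p :=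
      (φ.contDiff.differentiable (by simp)).differentiableAt.hasFDerivAt
    have h2 : HasFDerivAt (fun p : ℝ × ℝ => b p.1) _ p :=
      ((hb.differentiable (by simp)).differentiableAt.hasFDerivAt).comp p hasFDerivAt_fst
    rw [(h2.mul h).fderiv]
    simp
  rw [opM, Distribution.lineDerivOp_apply_apply, Distribution.lineDerivOp_apply_apply, e, map_neg,
    map_neg]
  ring

lemma integral_postcomp (φ : 𝓓(Ω, ℂ)) {f : ℝ × ℝ → ℂ} (hf : Continuous f) :
    (∫ p, ((TestFunction.postcompCLM Complex.reCLM φ p : ℝ) : ℂ) * f p) +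
      Complex.I * ∫ p, ((TestFunction.postcompCLM Complex.imCLM φ p : ℝ) : ℂ) * f p =
      ∫ p, φ p * f p := by
  have aux : ∀ L : ℂ →L[ℝ] ℝ,
      Integrable fun p => ((TestFunction.postcompCLM L φ p : ℝ) : ℂ) * f p := fun L =>
    Continuous.integrable_of_hasCompactSupport (by fun_prop)
      (HasCompactSupport.mul_right ((TestFunction.postcompCLM L φ).hasCompactSupport.comp_left
        (g := ((↑) : ℝ → ℂ)) rfl))
  rw [← integral_const_mul, ← integral_add (aux _) ((aux _).const_mul _)]
  refine integral_congr_ae (ae_of_all _ fun p => ?_)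
  simp only [TestFunction.postcompCLM_apply, Function.comp_apply, Complex.reCLM_apply,
    Complex.imCLM_apply]
  linear_combination f p * Complex.re_add_im (φ p)

lemma cext_opTest (hb : ContDiff ℝ ∞ b) {f : ℝ × ℝ → ℂ} (hf : Continuous f) {u : 𝓓'(Ω, ℂ)}
    (hu : IsSolution b hb f u) (φ : 𝓓(Ω, ℂ)) :
    cext u (opTest hb φ) = -∫ p, φ p * f p := by
  have aux : ∀ L : ℂ →L[ℝ] ℝ,
      TestFunction.postcompCLM L (∂_{((1, 0) : ℝ × ℝ)} φ) =
        ∂_{((1, 0) : ℝ × ℝ)} (TestFunction.postcompCLM L φ) ∧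
      TestFunction.postcompCLM L (mulSmooth (∂_{((0, 1) : ℝ × ℝ)} φ) (fun p => (b p.1 : ℂ))
        (Complex.ofRealCLM.contDiff.comp (hb.comp contDiff_fst))) =
        mulTest (fun p => b p.1) (hb.comp contDiff_fst)
          (∂_{((0, 1) : ℝ × ℝ)} (TestFunction.postcompCLM L φ)) := by
    intro L
    constructor
    · ext p
      rw [lineDeriv_testFunction_apply, fderiv_postcomp, TestFunction.postcompCLM_apply,
        Function.comp_apply, lineDeriv_testFunction_apply]
    · ext p
      change L (_ * _) = b p.1 * _
      rw [lineDeriv_testFunction_apply, lineDeriv_testFunction_apply, fderiv_postcomp, mul_comm,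
        ← Complex.real_smul, map_smul, smul_eq_mul]
  rw [← integral_postcomp φ hf, ← hu, ← hu, opM_eq, opM_eq, opTest, map_add, map_smul,
    cext_apply, cext_apply, (aux _).1, (aux _).1, (aux _).2, (aux _).2, smul_eq_mul]
  ring

end Transpose

/-! ### Analytic continuation of the Cauchy transform of f. -/

section CauchyTransform

variable {b : ℝ → ℝ} {f : ℝ × ℝ → ℂ}

/-- M is a derivation and MZ = 0, so functions of Z behave as constants. -/
lemma opTest_mulSmooth_cauchyKernel (hb : ContDiff ℝ ∞ b) (hpos : ∀ t : ℝ, t ≠ 0 → 0 < t * b t)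
    {Ω : Opens (ℝ × ℝ)} (χ : 𝓓(Ω, ℂ)) {w : ℂ} (hw : 0 < w.im) :
    opTest hb (mulSmooth χ _ (contDiff_cauchyKernel hb hpos hw)) =
      mulSmooth (opTest hb χ) _ (contDiff_cauchyKernel hb hpos hw) := by
  ext p
  rw [opTest_apply, mulSmooth_apply, opTest_apply]
  obtain ⟨L, hL, hL1, hL2⟩ := hasFDerivAt_firstIntegral hb p
  have hχ : HasFDerivAt χ (fderiv ℝ χ p) p :=
    (χ.contDiff.differentiable (by simp)).differentiableAt.hasFDerivAt
  have hE := (hasDerivAt_inv (firstIntegral_sub_ne_zero hb.continuous hpos hw p)).comp_hasFDerivAt p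
    (hL.sub_const w)
  have h := (hχ.mul hE).fderiv
  change fderiv ℝ (mulSmooth χ _ (contDiff_cauchyKernel hb hpos hw)) p = _ at h
  rw [h]
  simp [hL1, hL2]
  ring

/-- Integration of test functions, as a distribution on the plane. -/
def integralDistribution : 𝓓'((⊤ : Opens (ℝ × ℝ)), ℂ) :=
  Distribution.mapCLM Complex.ofRealCLM
    (TestFunction.integralAgainstBilinCLM (ContinuousLinearMap.mul ℝ ℝ) volume
      (fun _ : ℝ × ℝ => (1 : ℝ)) : 𝓓((⊤ : Opens (ℝ × ℝ)), ℝ) →L[ℝ] ℝ)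

lemma integralDistribution_apply (φ : 𝓓((⊤ : Opens (ℝ × ℝ)), ℝ)) :
    integralDistribution φ = ((∫ p, φ p : ℝ) : ℂ) := by
  have : LocallyIntegrableOn (fun _ : ℝ × ℝ => (1 : ℝ)) ((⊤ : Opens (ℝ × ℝ)) : Set (ℝ × ℝ)) :=
    (locallyIntegrable_const 1).locallyIntegrableOn _
  have h := TestFunction.integralAgainstBilinCLM_eq_integral
    (B := ContinuousLinearMap.mul ℝ ℝ) this (f := φ)
  simp only [ContinuousLinearMap.mul_apply', mul_one] at h
  change ((_ : ℝ) : ℂ) = _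
  rw [← h]
  rfl

lemma cext_integralDistribution (φ : 𝓓((⊤ : Opens (ℝ × ℝ)), ℂ)) :
    cext integralDistribution φ = ∫ p, φ p := by
  have h := integral_postcomp φ (f := fun _ => 1) continuous_const
  simp only [mul_one] at h
  rw [cext_apply, integralDistribution_apply, integralDistribution_apply, ← h,
    integral_complex_ofReal, integral_complex_ofReal]

/-- Split f = (1 - χ)f + χf with χ = 1 near the origin. The first part is paired with the
distribution of integration, the second is traded through the equation for u paired with Mχ/(Z - w);
in both, the amplitude vanishes near the origin. -/
lemma exists_analyticAt_cauchyTransform (hb : ContDiff ℝ ∞ b)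
    (hpos : ∀ t : ℝ, t ≠ 0 → 0 < t * b t) (hf : ContDiff ℝ ∞ f) (hfc : HasCompactSupport f)
    {Ω : Opens (ℝ × ℝ)} (h0 : (0, 0) ∈ Ω) {u : 𝓓'(Ω, ℂ)} (hu : IsSolution b hb f u) :
    ∃ G : ℂ → ℂ, AnalyticAt ℂ G 0 ∧ ∀ᶠ w in 𝓝 (0 : ℂ), 0 < w.im →
      ∫ p, f p * (firstIntegral b p - w)⁻¹ = G w := by
  obtain ⟨r, hr, hrΩ⟩ := Metric.isOpen_iff.1 Ω.isOpen _ h0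
  let c : ContDiffBump ((0, 0) : ℝ × ℝ) := ⟨r / 4, r / 2, by positivity, by linarith⟩
  have hcs : ContDiff ℝ ∞ fun p => (c p : ℂ) := Complex.ofRealCLM.contDiff.comp c.contDiff
  have hc1 : (fun p => (c p : ℂ)) =ᶠ[𝓝 (0, 0)] fun _ => 1 := by
    filter_upwards [c.eventuallyEq_one] with p hp
    simp [hp]
  let χ : 𝓓(Ω, ℂ) :=
    { toFun := fun p => (c p : ℂ)
      contDiff' := hcs
      hasCompactSupport' := c.hasCompactSupport.comp_left (g := ((↑) : ℝ → ℂ)) rfl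
      tsupport_subset' := by
        refine (tsupport_comp_subset (g := ((↑) : ℝ → ℂ)) rfl c).trans ?_
        rw [c.tsupport_eq]
        refine subset_trans (Metric.closedBall_subset_ball ?_) hrΩ
        change r / 2 < r
        linarith }
  have hχ1 : ⇑χ =ᶠ[𝓝 (0, 0)] fun _ => 1 := hc1
  let η : 𝓓((⊤ : Opens (ℝ × ℝ)), ℂ) :=
    { toFun := fun p => f p * (1 - c p)
      contDiff' := hf.mul (contDiff_const.sub hcs)
      hasCompactSupport' := hfc.mul_right
      tsupport_subset' := subset_univ _ }
  have hη0 : (0, 0) ∉ tsupport η := by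
    rw [notMem_tsupport_iff_eventuallyEq]
    filter_upwards [hc1] with p hp
    change f p * (1 - c p) = 0
    rw [hp]; simp
  have hψ0 : (0, 0) ∉ tsupport (opTest hb χ) := by
    rw [notMem_tsupport_iff_eventuallyEq]
    filter_upwards [hχ1.fderiv (𝕜 := ℝ)] with p hp
    rw [opTest_apply, hp]
    simp
  obtain ⟨G₁, hG₁, h₁⟩ := exists_analyticAt_cext_cauchy hb hpos u _ hψ0
  obtain ⟨G₂, hG₂, h₂⟩ := exists_analyticAt_cext_cauchy hb hpos integralDistribution η hη0
  refine ⟨fun w => G₂ w - G₁ w, hG₂.sub hG₁, ?_⟩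
  filter_upwards [h₁, h₂] with w hw₁ hw₂ hw
  rw [← hw₁ hw, ← hw₂ hw, ← opTest_mulSmooth_cauchyKernel hb hpos χ hw,
    cext_opTest hb hf.continuous hu, cext_integralDistribution, sub_neg_eq_add, ← integral_add]
  · refine integral_congr_ae (ae_of_all _ fun p => ?_)
    change _ = f p * (1 - c p) * _ + c p * _ * f p
    ring
  · exact (mulSmooth η _ _).continuous.integrable_of_hasCompactSupport
      (mulSmooth η _ _).hasCompactSupport
  · have := hf.continuous
    exact Continuous.integrable_of_hasCompactSupport (by fun_prop) hfc.mul_left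

end CauchyTransform

/-! ### Kf as a boundary value of the Cauchy transform; necessity. -/

section HalfPlane

variable {b : ℝ → ℝ} {f : ℝ × ℝ → ℂ}

/-- The Fourier coefficient of `Kf` at the frequency `ξ`. -/
def coeffKf (b : ℝ → ℝ) (f : ℝ × ℝ → ℂ) (ξ : ℝ) : ℂ :=
  ∫ s : ℝ, Complex.exp (-(primB b s * ξ)) * fourierX f s ξ

/-- The extension of `Kf` to the upper half-plane. -/
def halfKf (b : ℝ → ℝ) (f : ℝ × ℝ → ℂ) (w : ℂ) : ℂ :=
  ∫ ξ in Ioi (0 : ℝ), Complex.exp (Complex.I * w * ξ) * coeffKf b f ξ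

lemma exp_mul_coeffKf (w : ℂ) (ξ : ℝ) :
    Complex.exp (Complex.I * w * ξ) * coeffKf b f ξ = ∫ s : ℝ,
      Complex.exp (Complex.I * (w + Complex.I * (primB b s : ℂ)) * ξ) * fourierX f s ξ := by
  rw [coeffKf, ← integral_const_mul]
  refine integral_congr_ae (ae_of_all _ fun s => ?_)
  simp only
  rw [← mul_assoc, ← Complex.exp_add]
  congr 2
  linear_combination (-(primB b s * ξ : ℂ)) * Complex.I_sq

lemma Kf_eq_halfKf (x : ℝ) : Kf b f x = halfKf b f x := by
  unfold Kf halfKf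
  simp_rw [exp_mul_coeffKf]

lemma exists_time_bound (hfc : HasCompactSupport f) : ∃ T, 0 < T ∧ ∀ p ∈ tsupport f, |p.1| < T := by
  obtain ⟨R, hR⟩ := hfc.isCompact.isBounded.exists_norm_le
  refine ⟨max R 0 + 1, by positivity, fun p hp => ?_⟩
  have h1 : |p.1| ≤ ‖p‖ := norm_fst_le p
  linarith [hR p hp, le_max_left R 0]

lemma continuous_coeffKf (hb : ContDiff ℝ ∞ b) (hf : ContDiff ℝ ∞ f) (hfc : HasCompactSupport f) :
    Continuous (coeffKf b f) := by
  obtain ⟨T, -, hT⟩ := exists_time_bound hfc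
  have hB := continuous_primB hb.continuous
  have hF := continuous_fourierX hf.continuous hfc
  have := continuous_parametric_integral_of_continuous (μ := volume)
    (f := fun (ξ : ℝ) (s : ℝ) => Complex.exp (-(primB b s * ξ)) * fourierX f s ξ)
    ((by fun_prop : Continuous fun q : ℝ × ℝ =>
      Complex.exp (-(primB b q.2 * q.1))).mul (hF.comp continuous_swap))
    (isCompact_Icc (a := -T) (b := T))
  refine this.congr fun ξ => setIntegral_eq_integral_of_forall_compl_eq_zero fun s hs => ?_
  rw [fourierX_eq_zero hT, mul_zero]
  by_contra! h
  exact hs (abs_le.1 h.le)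

lemma exists_bound_coeffKf (hb : ContDiff ℝ ∞ b) (hpos : ∀ t : ℝ, t ≠ 0 → 0 < t * b t)
    (hf : ContDiff ℝ ∞ f) (hfc : HasCompactSupport f) :
    ∃ C, 0 ≤ C ∧ ∀ ξ, 0 < ξ → ‖coeffKf b f ξ‖ ≤ C * (1 + ξ ^ 2)⁻¹ := by
  obtain ⟨T, hT0, hT⟩ := exists_time_bound hfc
  obtain ⟨C, hC0, hC⟩ := exists_bound_fourierX hf hfc
  refine ⟨C * (2 * T), by positivity, fun ξ hξ => ?_⟩
  rw [coeffKf, ← setIntegral_eq_integral_of_forall_compl_eq_zero (s := Icc (-T) T)]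
  · refine (norm_setIntegral_le_of_norm_le_const (C := C * (1 + ξ ^ 2)⁻¹)
      isCompact_Icc.measure_lt_top fun s _ => ?_).trans_eq ?_
    · rw [norm_mul]
      have : ‖Complex.exp (-(primB b s * ξ))‖ ≤ 1 := by
        rw [Complex.norm_exp, Real.exp_le_one_iff]
        have := mul_nonneg (primB_nonneg hb.continuous hpos s) hξ.le
        simpa using this
      calc _ ≤ 1 * (C * (1 + ξ ^ 2)⁻¹) := by gcongr; exact hC s ξ
        _ = _ := one_mul _
    · rw [measureReal_def, Real.volume_Icc, ENNReal.toReal_ofReal (by linarith)]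
      ring
  · intro s hs
    rw [fourierX_eq_zero hT, mul_zero]
    by_contra! h
    exact hs (abs_le.1 h.le)

lemma tendsto_halfKf (hb : ContDiff ℝ ∞ b) (hpos : ∀ t : ℝ, t ≠ 0 → 0 < t * b t)
    (hf : ContDiff ℝ ∞ f) (hfc : HasCompactSupport f) (x : ℝ) :
    Tendsto (fun ε : ℝ => halfKf b f (x + Complex.I * ε)) (𝓝[>] 0) (𝓝 (Kf b f x)) := by
  obtain ⟨C, hC0, hC⟩ := exists_bound_coeffKf hb hpos hf hfc
  have hJ := continuous_coeffKf hb hf hfc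
  rw [Kf_eq_halfKf]
  refine tendsto_integral_filter_of_dominated_convergence (fun ξ => C * (1 + ξ ^ 2)⁻¹) ?_ ?_
    (integrable_bound C).integrableOn ?_
  · exact Eventually.of_forall fun ε => Continuous.aestronglyMeasurable (by fun_prop)
  · filter_upwards [self_mem_nhdsWithin] with ε hε
    filter_upwards [ae_restrict_mem measurableSet_Ioi] with ξ hξ
    rw [norm_mul]
    have : ‖Complex.exp (Complex.I * (x + Complex.I * ε) * ξ)‖ ≤ 1 := by
      rw [Complex.norm_exp, Real.exp_le_one_iff]
      have := mul_nonneg (le_of_lt hε) (mem_Ioi.1 hξ).le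
      simpa using this
    calc _ ≤ 1 * (C * (1 + ξ ^ 2)⁻¹) := by gcongr; exact hC ξ hξ
      _ = _ := one_mul _
  · refine ae_of_all _ fun ξ => ?_
    have : Continuous fun ε : ℝ =>
        Complex.exp (Complex.I * (x + Complex.I * ε) * ξ) * coeffKf b f ξ := by fun_prop
    have h := (this.tendsto 0).mono_left (nhdsWithin_le_nhds (s := Ioi 0))
    simpa using h

/-- For Im w > 0, ∫_0^∞ exp(-i(Z - w)ξ) dξ = 1/(i(Z - w)); the factor exp(-ξ Im w) justifies Fubini.
-/
lemma halfKf_eq_cauchyTransform (hb : ContDiff ℝ ∞ b) (hpos : ∀ t : ℝ, t ≠ 0 → 0 < t * b t)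
    (hf : ContDiff ℝ ∞ f) (hfc : HasCompactSupport f) {w : ℂ} (hw : 0 < w.im) :
    halfKf b f w = (2 * Real.pi * Complex.I)⁻¹ * ∫ p, f p * (firstIntegral b p - w)⁻¹ := by
  have hB := continuous_primB hb.continuous
  have hfi : Integrable f := hf.continuous.integrable_of_hasCompactSupport hfc
  let k : ℝ → ℝ × ℝ → ℂ := fun ξ p =>
    Complex.exp (-(Complex.I * (firstIntegral b p - w)) * ξ) * f p
  have hkn : ∀ (ξ : ℝ) p, 0 < ξ → ‖k ξ p‖ ≤ Real.exp (-w.im * ξ) * ‖f p‖ := by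
    intro ξ p hξ
    rw [norm_mul, Complex.norm_exp]
    gcongr
    have := mul_nonneg (primB_nonneg hb.continuous hpos p.1) hξ.le
    simp
    linarith
  have hkc : Continuous (Function.uncurry k) := by
    have := (contDiff_firstIntegral hb).continuous
    have := hf.continuous
    unfold Function.uncurry
    fun_prop
  have hki : Integrable (Function.uncurry k) ((volume.restrict (Ioi (0 : ℝ))).prod volume) := by
    have h1 : Integrable (fun ξ : ℝ => Real.exp (-w.im * ξ)) (volume.restrict (Ioi 0)) :=
      exp_neg_integrableOn_Ioi 0 hw
    refine (h1.mul_prod hfi.norm).mono' hkc.aestronglyMeasurable ?_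
    have : ∀ᵐ q : ℝ × (ℝ × ℝ) ∂((volume.restrict (Ioi (0 : ℝ))).prod volume), 0 < q.1 :=
      Measure.quasiMeasurePreserving_fst.ae (ae_restrict_mem measurableSet_Ioi)
    filter_upwards [this] with q hq
    exact hkn q.1 q.2 hq
  have h1 : ∀ ξ ∈ Ioi (0 : ℝ), Complex.exp (Complex.I * w * ξ) * coeffKf b f ξ =
      (1 / (2 * Real.pi)) * ∫ p, k ξ p := by
    intro ξ hξ
    have hint : Integrable (k ξ) :=
      (hfi.norm.const_mul (Real.exp (-w.im * ξ))).mono'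
        (by have := hkc.comp (by fun_prop : Continuous fun p : ℝ × ℝ => (ξ, p))
            exact this.aestronglyMeasurable) (ae_of_all _ fun p => hkn ξ p hξ)
    rw [exp_mul_coeffKf, Measure.volume_eq_prod, integral_prod _ hint, ← integral_const_mul]
    refine integral_congr_ae (ae_of_all _ fun s => ?_)
    simp only [fourierX]
    rw [mul_left_comm, ← integral_const_mul]
    congr 1
    refine integral_congr_ae (ae_of_all _ fun y => ?_)
    simp only [k, firstIntegral]
    rw [← mul_assoc, ← Complex.exp_add]
    congr 2
    ring
  rw [halfKf, setIntegral_congr_fun measurableSet_Ioi h1, integral_const_mul,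
    integral_integral_swap hki, ← integral_const_mul, ← integral_const_mul]
  refine integral_congr_ae (ae_of_all _ fun p => ?_)
  simp only [k]
  have hne := firstIntegral_sub_ne_zero hb.continuous hpos hw p
  have hre : (-(Complex.I * (firstIntegral b p - w))).re < 0 := by
    simp
    linarith [primB_nonneg hb.continuous hpos p.1]
  rw [integral_mul_const, integral_exp_mul_complex_Ioi hre]
  have : (Real.pi : ℂ) ≠ 0 := by simp [Real.pi_ne_zero]
  simp
  field_simp

theorem analyticAt_Kf_of_isSolution (hb : ContDiff ℝ ∞ b)
    (hpos : ∀ t : ℝ, t ≠ 0 → 0 < t * b t) (hf : ContDiff ℝ ∞ f) (hfc : HasCompactSupport f)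
    {Ω : Opens (ℝ × ℝ)} (h0 : (0, 0) ∈ Ω) {u : 𝓓'(Ω, ℂ)} (hu : IsSolution b hb f u) :
    AnalyticAt ℝ (Kf b f) 0 := by
  obtain ⟨G₀, hG₀, h⟩ := exists_analyticAt_cauchyTransform hb hpos hf hfc h0 hu
  set G : ℂ → ℂ := fun w => (2 * Real.pi * Complex.I)⁻¹ * G₀ w
  have hG : AnalyticAt ℂ G 0 := analyticAt_const.mul hG₀
  have hGr : AnalyticAt ℝ (fun x : ℝ => G x) 0 := by
    have h1 : AnalyticAt ℝ G (Complex.ofRealCLM 0) := by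
      simpa using hG.restrictScalars (𝕜 := ℝ)
    exact h1.comp (Complex.ofRealCLM.analyticAt 0)
  refine hGr.congr ?_
  obtain ⟨r, hr, hball⟩ := Metric.eventually_nhds_iff_ball.1 (h.and hG.eventually_analyticAt)
  filter_upwards [Metric.ball_mem_nhds (0 : ℝ) hr] with x hx
  have hx' : (x : ℂ) ∈ Metric.ball (0 : ℂ) r := by simpa using hx
  have hcont : Tendsto (fun ε : ℝ => (x + Complex.I * ε : ℂ)) (𝓝[>] 0) (𝓝 x) := by
    have : Continuous fun ε : ℝ => (x + Complex.I * ε : ℂ) := by fun_prop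
    have := (this.tendsto 0).mono_left (nhdsWithin_le_nhds (s := Ioi 0))
    simpa using this
  have hlim : Tendsto (fun ε : ℝ => halfKf b f (x + Complex.I * ε)) (𝓝[>] 0) (𝓝 (G x)) := by
    refine (((hball x hx').2.continuousAt.tendsto).comp hcont).congr' ?_
    filter_upwards [self_mem_nhdsWithin, hcont.eventually (Metric.isOpen_ball.mem_nhds hx')]
      with ε hε hmem
    have him : 0 < (x + Complex.I * ε : ℂ).im := by simpa using hε
    rw [halfKf_eq_cauchyTransform hb hpos hf hfc him, (hball _ hmem).1 him]
    rfl
  exact tendsto_nhds_unique hlim (tendsto_halfKf hb hpos hf hfc x)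

end HalfPlane

/-! ### Damped Fourier modes and their superpositions. -/

section Waves

variable {b : ℝ → ℝ} {f : ℝ × ℝ → ℂ}

/-- The solution vanishing at time `τ` of the Fourier transformed equation
`v' = b(t) ξ v + f̂(t, ξ)`. -/
def mode (b : ℝ → ℝ) (f : ℝ × ℝ → ℂ) (τ t ξ : ℝ) : ℂ :=
  ∫ s in τ..t, Complex.exp ((primB b t - primB b s) * ξ) * fourierX f s ξ

lemma mode_eq (τ t ξ : ℝ) : mode b f τ t ξ = Complex.exp (primB b t * ξ) *
    ∫ s in τ..t, Complex.exp (-(primB b s * ξ)) * fourierX f s ξ := by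
  rw [mode, ← intervalIntegral.integral_const_mul]
  congr 1
  ext s
  rw [← mul_assoc, ← Complex.exp_add]
  congr 2
  ring

lemma continuous_modeIntegrand (hb : ContDiff ℝ ∞ b) (hf : ContDiff ℝ ∞ f)
    (hfc : HasCompactSupport f) {X : Type*} [TopologicalSpace X] {σ ξ : X → ℝ}
    (hσ : Continuous σ) (hξ : Continuous ξ) :
    Continuous fun q => Complex.exp (-(primB b (σ q) * ξ q)) * fourierX f (σ q) (ξ q) := by
  have hB := continuous_primB hb.continuous
  have h : Continuous fun q => fourierX f (σ q) (ξ q) :=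
    (continuous_fourierX hf.continuous hfc).comp (hσ.prodMk hξ)
  fun_prop

lemma continuous_mode (hb : ContDiff ℝ ∞ b) (hf : ContDiff ℝ ∞ f) (hfc : HasCompactSupport f)
    (τ : ℝ) : Continuous fun q : ℝ × ℝ => mode b f τ q.1 q.2 := by
  have hB := continuous_primB hb.continuous
  simp_rw [mode_eq]
  refine Continuous.mul (by fun_prop) ?_
  refine intervalIntegral.continuous_parametric_intervalIntegral_of_continuous
    (f := fun (q : ℝ × ℝ) s => Complex.exp (-(primB b s * q.2)) * fourierX f s q.2) ?_ continuous_fst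
  exact continuous_modeIntegrand hb hf hfc (σ := fun z : (ℝ × ℝ) × ℝ => z.2)
    (ξ := fun z : (ℝ × ℝ) × ℝ => z.1.2) (by fun_prop) (by fun_prop)

lemma hasDerivAt_mode (hb : ContDiff ℝ ∞ b) (hf : ContDiff ℝ ∞ f) (hfc : HasCompactSupport f)
    (τ t ξ : ℝ) : HasDerivAt (fun t => mode b f τ t ξ)
      (b t * ξ * mode b f τ t ξ + fourierX f t ξ) t := by
  have hc : Continuous fun s => Complex.exp (-(primB b s * ξ)) * fourierX f s ξ :=
    continuous_modeIntegrand hb hf hfc continuous_id continuous_const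
  have h1 := intervalIntegral.integral_hasDerivAt_right (hc.intervalIntegrable τ t)
    (hc.stronglyMeasurableAtFilter _ _) hc.continuousAt
  have h2 : HasDerivAt (fun t => Complex.exp (primB b t * ξ))
      (Complex.exp (primB b t * ξ) * (b t * ξ)) t :=
    (((hasDerivAt_primB hb.continuous t).ofReal_comp).mul_const (ξ : ℂ)).cexp
  simp_rw [mode_eq]
  convert! h2.mul h1 using 1
  rw [← mul_assoc _ (Complex.exp _) (fourierX f t ξ), ← Complex.exp_add]
  simp
  ring

lemma mode_dx (hf : ContDiff ℝ ∞ f) (hfc : HasCompactSupport f) (τ t ξ : ℝ) :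
    mode b (dx f) τ t ξ = Complex.I * ξ * mode b f τ t ξ := by
  rw [mode, mode, ← intervalIntegral.integral_const_mul]
  congr 1
  ext s
  rw [fourierX_dx hf hfc]
  ring

/-- The modes with frequency in `S` started at time `τ` are damped at the times in `J`, which are
at distance at most `L` of `τ`. -/
structure IsDamped (b : ℝ → ℝ) (S : Set ℝ) (τ : ℝ) (J : Set ℝ) (L : ℝ) : Prop where
  measurableSet : MeasurableSet S
  nonpos : ∀ t ∈ J, ∀ ξ ∈ S, ∀ s ∈ uIoc τ t, (primB b t - primB b s) * ξ ≤ 0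
  le : ∀ t ∈ J, |t - τ| ≤ L

/-- The superposition of the modes with frequency in `S` started at time `τ`. -/
def wave (b : ℝ → ℝ) (f : ℝ × ℝ → ℂ) (S : Set ℝ) (τ : ℝ) (p : ℝ × ℝ) : ℂ :=
  ∫ ξ in S, Complex.exp (Complex.I * p.2 * ξ) * mode b f τ p.1 ξ

/-- The part of `f` with frequencies in `S`. -/
def freqPart (f : ℝ × ℝ → ℂ) (S : Set ℝ) (p : ℝ × ℝ) : ℂ :=
  ∫ ξ in S, Complex.exp (Complex.I * p.2 * ξ) * fourierX f p.1 ξ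

lemma norm_exp_I_mul_mul (x ξ : ℝ) : ‖Complex.exp (Complex.I * x * ξ)‖ = 1 := by
  rw [Complex.norm_exp]; simp

variable {S : Set ℝ} {τ L : ℝ} {J : Set ℝ}

lemma IsDamped.exists_bound (h : IsDamped b S τ J L) (hf : ContDiff ℝ ∞ f)
    (hfc : HasCompactSupport f) :
    ∃ C, 0 ≤ C ∧ ∀ t ∈ J, ∀ ξ ∈ S, ‖mode b f τ t ξ‖ ≤ C * (1 + ξ ^ 2)⁻¹ := by
  obtain ⟨C, hC0, hC⟩ := exists_bound_fourierX hf hfc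
  refine ⟨C * |L|, by positivity, fun t ht ξ hξ => ?_⟩
  refine (intervalIntegral.norm_integral_le_of_norm_le_const (C := C * (1 + ξ ^ 2)⁻¹)
    fun s hs => ?_).trans ?_
  · rw [norm_mul]
    have : ‖Complex.exp ((primB b t - primB b s) * ξ)‖ ≤ 1 := by
      rw [Complex.norm_exp, Real.exp_le_one_iff]
      simpa using h.nonpos t ht ξ hξ s hs
    calc _ ≤ 1 * (C * (1 + ξ ^ 2)⁻¹) := by gcongr; exact hC s ξ
      _ = _ := one_mul _
  · have : |t - τ| ≤ |L| := (h.le t ht).trans (le_abs_self L)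
    calc _ ≤ C * (1 + ξ ^ 2)⁻¹ * |L| := by gcongr
      _ = _ := by ring

lemma continuous_waveIntegrand (hb : ContDiff ℝ ∞ b) (hf : ContDiff ℝ ∞ f)
    (hfc : HasCompactSupport f) (τ : ℝ) : Continuous fun q : (ℝ × ℝ) × ℝ =>
      Complex.exp (Complex.I * q.1.2 * q.2) * mode b f τ q.1.1 q.2 :=
  Continuous.mul (by fun_prop) ((continuous_mode hb hf hfc τ).comp
    (by fun_prop : Continuous fun q : (ℝ × ℝ) × ℝ => (q.1.1, q.2)))

lemma continuous_waveIntegrand_right (hb : ContDiff ℝ ∞ b) (hf : ContDiff ℝ ∞ f)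
    (hfc : HasCompactSupport f) (τ t x : ℝ) : Continuous fun ξ : ℝ =>
      Complex.exp (Complex.I * x * ξ) * mode b f τ t ξ :=
  (continuous_waveIntegrand hb hf hfc τ).comp (by fun_prop : Continuous fun ξ : ℝ => ((t, x), ξ))

lemma IsDamped.integrableOn (h : IsDamped b S τ J L) (hb : ContDiff ℝ ∞ b) (hf : ContDiff ℝ ∞ f)
    (hfc : HasCompactSupport f) {t : ℝ} (ht : t ∈ J) (x : ℝ) :
    IntegrableOn (fun ξ : ℝ => Complex.exp (Complex.I * x * ξ) * mode b f τ t ξ) S := by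
  obtain ⟨C, hC0, hC⟩ := h.exists_bound hf hfc
  refine (integrable_bound C).integrableOn.mono'
    (continuous_waveIntegrand_right hb hf hfc τ t x).aestronglyMeasurable ?_
  filter_upwards [ae_restrict_mem h.measurableSet] with ξ hξ
  rw [norm_mul, norm_exp_I_mul_mul, one_mul]
  exact hC t ht ξ hξ

lemma IsDamped.continuousOn_wave (h : IsDamped b S τ J L) (hb : ContDiff ℝ ∞ b)
    (hf : ContDiff ℝ ∞ f) (hfc : HasCompactSupport f) :
    ContinuousOn (wave b f S τ) (J ×ˢ univ) := by
  obtain ⟨C, hC0, hC⟩ := h.exists_bound hf hfc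
  refine continuousOn_of_dominated (bound := fun ξ => C * (1 + ξ ^ 2)⁻¹) ?_ ?_
    (integrable_bound C).integrableOn ?_
  · exact fun p _ => (continuous_waveIntegrand_right hb hf hfc τ p.1 p.2).aestronglyMeasurable
  · intro p hp
    filter_upwards [ae_restrict_mem h.measurableSet] with ξ hξ
    rw [norm_mul, norm_exp_I_mul_mul, one_mul]
    exact hC _ hp.1 ξ hξ
  · exact ae_of_all _ fun ξ => ((continuous_waveIntegrand hb hf hfc τ).comp
      (by fun_prop : Continuous fun p : ℝ × ℝ => (p, ξ))).continuousOn

lemma IsDamped.hasDerivAt_wave_snd (h : IsDamped b S τ J L) (hb : ContDiff ℝ ∞ b)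
    (hf : ContDiff ℝ ∞ f) (hfc : HasCompactSupport f) {t : ℝ} (ht : t ∈ J) (x : ℝ) :
    HasDerivAt (fun x => wave b f S τ (t, x)) (wave b (dx f) S τ (t, x)) x := by
  obtain ⟨C, hC0, hC⟩ := h.exists_bound (contDiff_dx hf) (hasCompactSupport_dx hfc)
  refine (hasDerivAt_integral_of_dominated_loc_of_deriv_le (s := univ)
    (bound := fun ξ => C * (1 + ξ ^ 2)⁻¹)
    (F := fun (x : ℝ) (ξ : ℝ) => Complex.exp (Complex.I * x * ξ) * mode b f τ t ξ)
    (F' := fun (x : ℝ) (ξ : ℝ) => Complex.exp (Complex.I * x * ξ) * mode b (dx f) τ t ξ)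
    univ_mem ?_ (h.integrableOn hb hf hfc ht x) ?_ ?_ (integrable_bound C).integrableOn ?_).2
  · exact Eventually.of_forall fun y =>
      (continuous_waveIntegrand_right hb hf hfc τ t y).aestronglyMeasurable
  · exact (continuous_waveIntegrand_right hb (contDiff_dx hf) (hasCompactSupport_dx hfc) τ t
      x).aestronglyMeasurable
  · filter_upwards [ae_restrict_mem h.measurableSet] with ξ hξ y _
    rw [norm_mul, norm_exp_I_mul_mul, one_mul]
    exact hC t ht ξ hξ
  · refine ae_of_all _ fun ξ y _ => ?_
    have h1 : HasDerivAt (fun y : ℝ => Complex.I * y * ξ) (Complex.I * 1 * ξ) y :=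
      ((Complex.ofRealCLM.hasDerivAt (x := y)).const_mul Complex.I).mul_const (ξ : ℂ)
    convert! h1.cexp.mul_const (mode b f τ t ξ) using 1
    rw [mode_dx hf hfc]
    ring

lemma integrable_fourierX_mul_exp (hf : ContDiff ℝ ∞ f) (hfc : HasCompactSupport f) (t x : ℝ) :
    Integrable fun ξ : ℝ => Complex.exp (Complex.I * x * ξ) * fourierX f t ξ := by
  obtain ⟨C, hC0, hC⟩ := exists_bound_fourierX hf hfc
  refine (integrable_bound C).mono' (Continuous.aestronglyMeasurable ?_) (ae_of_all _ fun ξ => ?_)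
  · exact Continuous.mul (by fun_prop) ((continuous_fourierX hf.continuous hfc).comp
      (by fun_prop : Continuous fun ξ : ℝ => (t, ξ)))
  · rw [norm_mul, norm_exp_I_mul_mul, one_mul]
    exact hC t ξ

lemma IsDamped.hasDerivAt_wave_fst (h : IsDamped b S τ J L) (hb : ContDiff ℝ ∞ b)
    (hf : ContDiff ℝ ∞ f) (hfc : HasCompactSupport f) {t : ℝ} (ht : J ∈ 𝓝 t) (x : ℝ) :
    HasDerivAt (fun t => wave b f S τ (t, x))
      (freqPart f S (t, x) - Complex.I * b t * wave b (dx f) S τ (t, x)) t := by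
  have htJ := mem_of_mem_nhds ht
  obtain ⟨C, hC0, hC⟩ := exists_bound_fourierX hf hfc
  obtain ⟨D, hD0, hD⟩ := h.exists_bound (contDiff_dx hf) (hasCompactSupport_dx hfc)
  -- Bounding b near t makes the derivative integrand dominated uniformly in time.
  have hbt : ∀ᶠ r in 𝓝 t, |b r| < |b t| + 1 :=
    hb.continuous.abs.continuousAt.eventually_lt_const (by linarith)
  have hi1 := integrable_fourierX_mul_exp hf hfc t x
  have hi2 := h.integrableOn hb (contDiff_dx hf) (hasCompactSupport_dx hfc) htJ x
  have key := (hasDerivAt_integral_of_dominated_loc_of_deriv_le (μ := volume.restrict S)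
    (s := J ∩ {r | |b r| < |b t| + 1})
    (bound := fun ξ => (C + (|b t| + 1) * D) * (1 + ξ ^ 2)⁻¹)
    (F := fun (r : ℝ) (ξ : ℝ) => Complex.exp (Complex.I * x * ξ) * mode b f τ r ξ)
    (F' := fun (r : ℝ) (ξ : ℝ) => Complex.exp (Complex.I * x * ξ) * fourierX f r ξ -
      Complex.I * b r * (Complex.exp (Complex.I * x * ξ) * mode b (dx f) τ r ξ))
    (inter_mem ht hbt) ?_ (h.integrableOn hb hf hfc htJ x) ?_ ?_
      (integrable_bound _).integrableOn ?_).2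
  · rw [integral_sub hi1.integrableOn (hi2.const_mul _), integral_const_mul] at key
    exact key
  · exact Eventually.of_forall fun r =>
      (continuous_waveIntegrand_right hb hf hfc τ r x).aestronglyMeasurable
  · exact hi1.integrableOn.aestronglyMeasurable.sub (hi2.const_mul _).aestronglyMeasurable
  · filter_upwards [ae_restrict_mem h.measurableSet] with ξ hξ r hr
    refine (norm_sub_le _ _).trans ?_
    simp only [norm_mul, norm_exp_I_mul_mul, one_mul, Complex.norm_I, Complex.norm_real,
      Real.norm_eq_abs]
    calc _ ≤ C * (1 + ξ ^ 2)⁻¹ + (|b t| + 1) * (D * (1 + ξ ^ 2)⁻¹) := by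
          gcongr
          · exact hC r ξ
          · exact hr.2.le
          · exact hD r hr.1 ξ hξ
      _ = _ := by ring
  · refine ae_of_all _ fun ξ r _ => ?_
    convert! (hasDerivAt_mode hb hf hfc τ r ξ).const_mul (Complex.exp (Complex.I * x * ξ)) using 1
    rw [mode_dx hf hfc]
    linear_combination (-(b r * Complex.exp (Complex.I * x * ξ) * ξ * mode b f τ r ξ)) *
      Complex.I_sq

/-- B increases away from t = 0, so negative frequencies are damped when moving away from 0.
Positive ones are damped only when moving towards 0, which forces the two starting times -T and T
below. -/
lemma isDamped_neg (hb : ContDiff ℝ ∞ b) (hpos : ∀ t : ℝ, t ≠ 0 → 0 < t * b t) (T : ℝ) :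
    IsDamped b (Iio 0) 0 (Icc (-T) T) T where
  measurableSet := measurableSet_Iio
  nonpos t _ ξ hξ s hs := by
    refine mul_nonpos_of_nonneg_of_nonpos (sub_nonneg.2 ?_) (le_of_lt hξ)
    rcases le_total 0 t with h | h
    · rw [uIoc_of_le h] at hs
      exact (strictMonoOn_primB hb.continuous hpos).monotoneOn hs.1.le h hs.2
    · rw [uIoc_of_ge h] at hs
      exact (strictAntiOn_primB hb.continuous hpos).antitoneOn h hs.2 hs.1.le
  le t ht := by rw [sub_zero]; exact abs_le.2 ht

lemma isDamped_pos_left (hb : ContDiff ℝ ∞ b) (hpos : ∀ t : ℝ, t ≠ 0 → 0 < t * b t) (T : ℝ) :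
    IsDamped b (Ioi 0) (-T) (Icc (-T) 0) T where
  measurableSet := measurableSet_Ioi
  nonpos t ht ξ hξ s hs := by
    refine mul_nonpos_of_nonpos_of_nonneg (sub_nonpos.2 ?_) (le_of_lt hξ)
    rw [uIoc_of_le ht.1] at hs
    exact (strictAntiOn_primB hb.continuous hpos).antitoneOn (hs.2.trans ht.2) ht.2 hs.2
  le t ht := by
    rw [abs_le]
    constructor <;> linarith [ht.1, ht.2]

lemma isDamped_pos_right (hb : ContDiff ℝ ∞ b) (hpos : ∀ t : ℝ, t ≠ 0 → 0 < t * b t) (T : ℝ) :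
    IsDamped b (Ioi 0) T (Icc 0 T) T where
  measurableSet := measurableSet_Ioi
  nonpos t ht ξ hξ s hs := by
    refine mul_nonpos_of_nonpos_of_nonneg (sub_nonpos.2 ?_) (le_of_lt hξ)
    rw [uIoc_of_ge ht.2] at hs
    exact (strictMonoOn_primB hb.continuous hpos).monotoneOn ht.1 (ht.1.trans hs.1.le) hs.1.le
  le t ht := by
    rw [abs_le]
    constructor <;> linarith [ht.1, ht.2]

lemma freqPart_add_freqPart (hf : ContDiff ℝ ∞ f) (hfc : HasCompactSupport f) (p : ℝ × ℝ) :
    freqPart f (Iio 0) p + freqPart f (Ioi 0) p = f p := by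
  have hi := integrable_fourierX_mul_exp hf hfc p.1 p.2
  -- The frequency 0 belongs to neither half-line; it is a null set and is added to the positive
  -- side.
  rw [← fourierX_inversion hf hfc p.1 p.2, freqPart, freqPart, ← integral_Ici_eq_integral_Ioi,
    ← setIntegral_union _ measurableSet_Ici hi.integrableOn hi.integrableOn, Iio_union_Ici,
    setIntegral_univ]
  exact (Iio_disjoint_Ici le_rfl)

/-- At t = 0 the factor exp(B(t)ξ) is 1, and the integrals from -T to 0 and from 0 to T join into
one over the whole time support of f. -/
lemma wave_sub_wave_eq_Kf (hb : ContDiff ℝ ∞ b) (hpos : ∀ t : ℝ, t ≠ 0 → 0 < t * b t)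
    (hf : ContDiff ℝ ∞ f) (hfc : HasCompactSupport f) {T : ℝ} (hT0 : 0 < T)
    (hT : ∀ p ∈ tsupport f, |p.1| < T) (x : ℝ) :
    wave b f (Ioi 0) (-T) (0, x) - wave b f (Ioi 0) T (0, x) = Kf b f x := by
  rw [wave, wave, ← integral_sub
    ((isDamped_pos_left hb hpos T).integrableOn hb hf hfc (by simp [hT0.le]) x)
    ((isDamped_pos_right hb hpos T).integrableOn hb hf hfc (by simp [hT0.le]) x),
    Kf_eq_halfKf, halfKf]
  refine integral_congr_ae (ae_of_all _ fun ξ => ?_)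
  simp only
  have hc : Continuous fun s => Complex.exp (-(primB b s * ξ)) * fourierX f s ξ :=
    continuous_modeIntegrand hb hf hfc continuous_id continuous_const
  rw [← mul_sub, mode_eq, mode_eq]
  simp only [primB_zero, Complex.ofReal_zero, zero_mul, Complex.exp_zero, one_mul]
  rw [intervalIntegral.integral_symm 0 T, sub_neg_eq_add,
    intervalIntegral.integral_add_adjacent_intervals (hc.intervalIntegrable _ _)
      (hc.intervalIntegrable _ _), coeffKf,
    intervalIntegral.integral_of_le (by linarith), ← integral_Icc_eq_integral_Ioc,
    setIntegral_eq_integral_of_forall_compl_eq_zero]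
  intro s hs
  rw [fourierX_eq_zero hT, mul_zero]
  by_contra! h
  exact hs (abs_le.1 h.le)

end Waves

/-! ### Gluing across t = 0 and smoothness of the solution. -/

section Gluing

/-- The derivative tends to g(a) from each side and f is continuous, so both one-sided derivatives
exist and agree. -/
lemma hasDerivAt_of_eventually_hasDerivAt_of_ne {f g : ℝ → ℂ} {a : ℝ}
    (h : ∀ᶠ y in 𝓝[≠] a, HasDerivAt f (g y) y) (hf : ContinuousAt f a) (hg : ContinuousAt g a) :
    HasDerivAt f (g a) a := by
  have aux : ∀ s : Set ℝ, s ⊆ {a}ᶜ → (∀ᶠ y in 𝓝[s] a, HasDerivAt f (g y) y) := fun s hs =>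
    nhdsWithin_mono a hs h
  have lim : ∀ s : Set ℝ, s ⊆ {a}ᶜ → Tendsto (deriv f) (𝓝[s] a) (𝓝 (g a)) := fun s hs =>
    (hg.tendsto.mono_left nhdsWithin_le_nhds).congr' <| by
      filter_upwards [aux s hs] with y hy using hy.deriv.symm
  have hr : Ioi a ⊆ {a}ᶜ := fun y hy => ne_of_gt hy
  have hl : Iio a ⊆ {a}ᶜ := fun y hy => ne_of_lt hy
  have h1 := hasDerivWithinAt_Ici_of_tendsto_deriv (s := {y | HasDerivAt f (g y) y})
    (fun y hy => hy.differentiableAt.differentiableWithinAt) hf.continuousWithinAt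
    (aux _ hr) (lim _ hr)
  have h2 := hasDerivWithinAt_Iic_of_tendsto_deriv (s := {y | HasDerivAt f (g y) y})
    (fun y hy => hy.differentiableAt.differentiableWithinAt) hf.continuousWithinAt
    (aux _ hl) (lim _ hl)
  simpa using h2.union h1

variable {b : ℝ → ℝ} {f : ℝ × ℝ → ℂ} {H : ℂ → ℂ} {T r : ℝ}

/-- A smooth right-hand side `f` supported in `|t| < T`, together with a holomorphic function `H`
on the disc of radius `r` which extends `Kf`. -/
structure IsExtension (b : ℝ → ℝ) (T r : ℝ) (f : ℝ × ℝ → ℂ) (H : ℂ → ℂ) : Prop where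
  contDiff : ContDiff ℝ ∞ f
  hasCompactSupport : HasCompactSupport f
  lt : ∀ p ∈ tsupport f, |p.1| < T
  differentiableOn : DifferentiableOn ℂ H (Metric.ball 0 r)
  eq_Kf : ∀ x : ℝ, |x| < r → H x = Kf b f x

lemma hasDerivAt_Kf (hb : ContDiff ℝ ∞ b) (hpos : ∀ t : ℝ, t ≠ 0 → 0 < t * b t)
    (hf : ContDiff ℝ ∞ f) (hfc : HasCompactSupport f) (x : ℝ) :
    HasDerivAt (Kf b f) (Kf b (dx f) x) x := by
  obtain ⟨T, hT0, hT⟩ := exists_time_bound hfc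
  have e := funext (wave_sub_wave_eq_Kf hb hpos hf hfc hT0 hT)
  rw [← e, ← wave_sub_wave_eq_Kf hb hpos (contDiff_dx hf) (hasCompactSupport_dx hfc) hT0
    fun p hp => hT p (tsupport_dx_subset hp)]
  exact ((isDamped_pos_left hb hpos T).hasDerivAt_wave_snd hb hf hfc (by simp [hT0.le]) x).sub
    ((isDamped_pos_right hb hpos T).hasDerivAt_wave_snd hb hf hfc (by simp [hT0.le]) x)

/-- Closure under (f, H) ↦ (∂_x f, H') with the same T and r is what drives the induction on
smoothness, as the domain never shrinks. -/
lemma IsExtension.dx (h : IsExtension b T r f H) (hb : ContDiff ℝ ∞ b)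
    (hpos : ∀ t : ℝ, t ≠ 0 → 0 < t * b t) : IsExtension b T r (dx f) (deriv H) where
  contDiff := contDiff_dx h.contDiff
  hasCompactSupport := hasCompactSupport_dx h.hasCompactSupport
  lt p hp := h.lt p (tsupport_dx_subset hp)
  differentiableOn := h.differentiableOn.deriv Metric.isOpen_ball
  eq_Kf x hx := by
    have hx' : (x : ℂ) ∈ Metric.ball (0 : ℂ) r := by simpa using hx
    have h1 : HasDerivAt (fun y : ℝ => H y) (deriv H x) x :=
      (h.differentiableOn.differentiableAt
        (Metric.isOpen_ball.mem_nhds hx')).hasDerivAt.comp_ofReal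
    have h2 := hasDerivAt_Kf hb hpos h.contDiff h.hasCompactSupport x
    refine h1.unique (h2.congr_of_eventuallyEq ?_)
    have : ∀ᶠ y : ℝ in 𝓝 x, |y| < r := continuous_abs.continuousAt.eventually_lt_const hx
    filter_upwards [this] with y hy using h.eq_Kf y hy

/-- The open set on which the solution is defined. -/
def solutionDomain (b : ℝ → ℝ) (T r : ℝ) : Set (ℝ × ℝ) := {p | |p.1| < T ∧ ‖firstIntegral b p‖ < r}

lemma isOpen_solutionDomain (hb : ContDiff ℝ ∞ b) : IsOpen (solutionDomain b T r) := by
  have := (contDiff_firstIntegral hb).continuous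
  exact (isOpen_lt (f := fun p : ℝ × ℝ => |p.1|) (by fun_prop) continuous_const).inter
    (isOpen_lt (f := fun p : ℝ × ℝ => ‖firstIntegral b p‖) (by fun_prop) continuous_const)

/-- The solution, glued along the line `t = 0`. -/
def solution (b : ℝ → ℝ) (T : ℝ) (f : ℝ × ℝ → ℂ) (H : ℂ → ℂ) (p : ℝ × ℝ) : ℂ :=
  wave b f (Iio 0) 0 p +
    if p.1 ≤ 0 then wave b f (Ioi 0) (-T) p else wave b f (Ioi 0) T p + H (firstIntegral b p)

lemma IsExtension.hasDerivAt (h : IsExtension b T r f H) {p : ℝ × ℝ}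
    (hp : p ∈ solutionDomain b T r) :
    HasDerivAt H (deriv H (firstIntegral b p)) (firstIntegral b p) :=
  (h.differentiableOn.differentiableAt
    (Metric.isOpen_ball.mem_nhds (by simpa using hp.2))).hasDerivAt

lemma hasDerivAt_firstIntegral_snd (t x : ℝ) :
    HasDerivAt (fun y => firstIntegral b (t, y)) 1 x := by
  have := (Complex.ofRealCLM.hasDerivAt (x := x)).sub_const (Complex.I * primB b t)
  exact this

lemma hasDerivAt_firstIntegral_fst (hb : ContDiff ℝ ∞ b) (t x : ℝ) :
    HasDerivAt (fun s => firstIntegral b (s, x)) (-(Complex.I * b t)) t := by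
  have := (((hasDerivAt_primB hb.continuous t).ofReal_comp).const_mul Complex.I).const_sub (x : ℂ)
  exact this

lemma IsExtension.continuousOn_solution (h : IsExtension b T r f H) (hb : ContDiff ℝ ∞ b)
    (hpos : ∀ t : ℝ, t ≠ 0 → 0 < t * b t) (hT0 : 0 < T) :
    ContinuousOn (solution b T f H) (solutionDomain b T r) := by
  obtain ⟨hf, hfc, hT, hH, hK⟩ := h
  refine (((isDamped_neg hb hpos T).continuousOn_wave hb hf hfc).mono ?_).add
    (ContinuousOn.if ?_ ?_ ?_)
  · exact fun p hp => ⟨abs_le.1 hp.1.le, mem_univ _⟩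
  -- Matching at the interface: on t = 0 one has Z = x, and H(x) = Kf(x) is exactly the jump.
  · intro p hp
    have h0 : p.1 = 0 := frontier_le_subset_eq continuous_fst continuous_const hp.2
    obtain ⟨t, x⟩ := p
    obtain rfl : t = 0 := h0
    have hx := hp.1.2
    simp only [firstIntegral, primB_zero, Complex.ofReal_zero, mul_zero, sub_zero,
      Complex.norm_real, Real.norm_eq_abs] at hx ⊢
    rw [hK x hx, ← wave_sub_wave_eq_Kf hb hpos hf hfc hT0 hT]
    ring
  · refine ((isDamped_pos_left hb hpos T).continuousOn_wave hb hf hfc).mono ?_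
    rintro p ⟨hp, hp'⟩
    rw [(isClosed_le continuous_fst continuous_const).closure_eq] at hp'
    exact ⟨⟨(abs_le.1 hp.1.le).1, hp'⟩, mem_univ _⟩
  · refine (((isDamped_pos_right hb hpos T).continuousOn_wave hb hf hfc).mono ?_).add
      (hH.continuousOn.comp (contDiff_firstIntegral hb).continuous.continuousOn ?_)
    · rintro p ⟨hp, hp'⟩
      refine ⟨⟨?_, (abs_le.1 hp.1.le).2⟩, mem_univ _⟩
      refine closure_minimal (t := {p : ℝ × ℝ | 0 ≤ p.1}) (fun q hq => ?_)
        (isClosed_le continuous_const continuous_fst) hp'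
      exact (not_le.1 hq).le
    · exact fun p hp => by simpa using hp.1.2

lemma IsExtension.hasDerivAt_solution_snd (h : IsExtension b T r f H) (hb : ContDiff ℝ ∞ b)
    (hpos : ∀ t : ℝ, t ≠ 0 → 0 < t * b t) {p : ℝ × ℝ} (hp : p ∈ solutionDomain b T r) :
    HasDerivAt (fun x => solution b T f H (p.1, x))
      (solution b T (Mizohata.dx f) (deriv H) p) p.2 := by
  have hp1 := abs_le.1 hp.1.le
  refine ((isDamped_neg hb hpos T).hasDerivAt_wave_snd hb h.contDiff h.hasCompactSupport hp1
    p.2).add ?_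
  by_cases ht : p.1 ≤ 0
  · simp only [ht, if_true]
    exact (isDamped_pos_left hb hpos T).hasDerivAt_wave_snd hb h.contDiff h.hasCompactSupport
      ⟨hp1.1, ht⟩ p.2
  · simp only [ht, if_false]
    refine ((isDamped_pos_right hb hpos T).hasDerivAt_wave_snd hb h.contDiff h.hasCompactSupport
      ⟨(not_le.1 ht).le, hp1.2⟩ p.2).add ?_
    have := (h.hasDerivAt hp).scomp p.2 (hasDerivAt_firstIntegral_snd (b := b) p.1 p.2)
    rwa [one_smul] at this

lemma IsExtension.hasDerivAt_solution_fst_of_ne (h : IsExtension b T r f H) (hb : ContDiff ℝ ∞ b)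
    (hpos : ∀ t : ℝ, t ≠ 0 → 0 < t * b t) {p : ℝ × ℝ} (hp : p ∈ solutionDomain b T r)
    (h0 : p.1 ≠ 0) :
    HasDerivAt (fun t => solution b T f H (t, p.2))
      (f p - Complex.I * b p.1 * solution b T (Mizohata.dx f) (deriv H) p) p.1 := by
  have hp1 := abs_lt.1 hp.1
  have h1 := (isDamped_neg hb hpos T).hasDerivAt_wave_fst hb h.contDiff h.hasCompactSupport
    (Icc_mem_nhds hp1.1 hp1.2) p.2
  have hfp := freqPart_add_freqPart h.contDiff h.hasCompactSupport p
  rcases lt_or_gt_of_ne h0 with ht | ht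
  · have h2 := (isDamped_pos_left hb hpos T).hasDerivAt_wave_fst hb h.contDiff h.hasCompactSupport
      (Icc_mem_nhds hp1.1 ht) p.2
    refine ((h1.add h2).congr_of_eventuallyEq ?_).congr_deriv ?_
    · filter_upwards [Iio_mem_nhds ht] with t ht'
      simp [solution, (mem_Iio.1 ht').le]
    · simp only [solution, ht.le, if_true]
      linear_combination hfp
  · have h2 := (isDamped_pos_right hb hpos T).hasDerivAt_wave_fst hb h.contDiff h.hasCompactSupport
      (Icc_mem_nhds ht hp1.2) p.2
    have h3 := (h.hasDerivAt hp).scomp p.1 (hasDerivAt_firstIntegral_fst hb p.1 p.2)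
    refine ((h1.add (h2.add h3)).congr_of_eventuallyEq ?_).congr_deriv ?_
    · filter_upwards [Ioi_mem_nhds ht] with t ht'
      simp [solution, not_le.2 (mem_Ioi.1 ht')]
    · simp only [solution, not_le.2 ht, if_false, smul_eq_mul]
      linear_combination hfp

/-- On t = 0 the two sides are glued only continuously; the equation expresses ∂_t through f and the
glued solution for (∂_x f, H'), also continuous, so the formula extends across. -/
lemma IsExtension.hasDerivAt_solution_fst (h : IsExtension b T r f H) (hb : ContDiff ℝ ∞ b)
    (hpos : ∀ t : ℝ, t ≠ 0 → 0 < t * b t) (hT0 : 0 < T) {p : ℝ × ℝ}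
    (hp : p ∈ solutionDomain b T r) :
    HasDerivAt (fun t => solution b T f H (t, p.2))
      (f p - Complex.I * b p.1 * solution b T (Mizohata.dx f) (deriv H) p) p.1 := by
  rcases ne_or_eq p.1 0 with h0 | h0
  · exact h.hasDerivAt_solution_fst_of_ne hb hpos hp h0
  have hmem := (isOpen_solutionDomain hb).mem_nhds hp
  have hline : ContinuousAt (fun t : ℝ => (t, p.2)) p.1 := by fun_prop
  have hc1 : ContinuousAt (fun t => solution b T f H (t, p.2)) p.1 :=
    ((h.continuousOn_solution hb hpos hT0).continuousAt hmem).comp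
      (f := fun t : ℝ => (t, p.2)) hline
  have hc2 : ContinuousAt (fun t => solution b T (Mizohata.dx f) (deriv H) (t, p.2)) p.1 :=
    (((h.dx hb hpos).continuousOn_solution hb hpos hT0).continuousAt hmem).comp
      (f := fun t : ℝ => (t, p.2)) hline
  refine hasDerivAt_of_eventually_hasDerivAt_of_ne
    (g := fun t => f (t, p.2) - Complex.I * b t * solution b T (Mizohata.dx f) (deriv H) (t, p.2))
    ?_ hc1 ?_
  · filter_upwards [nhdsWithin_le_nhds (hline.preimage_mem_nhds hmem), self_mem_nhdsWithin]
      with t ht htne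
    exact h.hasDerivAt_solution_fst_of_ne hb hpos ht (by rwa [h0] at htne)
  · have := h.contDiff.continuous
    have := hb.continuous
    exact ContinuousAt.sub (by fun_prop) (ContinuousAt.mul (by fun_prop) hc2)

/-- The differential of the solution. -/
def solutionFDeriv (b : ℝ → ℝ) (T : ℝ) (f : ℝ × ℝ → ℂ) (H : ℂ → ℂ) (p : ℝ × ℝ) : ℝ × ℝ →L[ℝ] ℂ :=
  (f p - Complex.I * b p.1 * solution b T (dx f) (deriv H) p) •
      Complex.ofRealCLM.comp (ContinuousLinearMap.fst ℝ ℝ ℝ) +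
    solution b T (dx f) (deriv H) p • Complex.ofRealCLM.comp (ContinuousLinearMap.snd ℝ ℝ ℝ)

lemma IsExtension.hasFDerivAt_solution (h : IsExtension b T r f H) (hb : ContDiff ℝ ∞ b)
    (hpos : ∀ t : ℝ, t ≠ 0 → 0 < t * b t) (hT0 : 0 < T) {p : ℝ × ℝ}
    (hp : p ∈ solutionDomain b T r) :
    HasFDerivAt (solution b T f H) (solutionFDeriv b T f H p) p := by
  have hmem := (isOpen_solutionDomain (T := T) (r := r) hb).mem_nhds hp
  have hc2 : ContinuousAt (solution b T (Mizohata.dx f) (deriv H)) p :=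
    ((h.dx hb hpos).continuousOn_solution hb hpos hT0).continuousAt hmem
  have hc1 : ContinuousAt (fun p : ℝ × ℝ =>
      f p - Complex.I * b p.1 * solution b T (Mizohata.dx f) (deriv H) p) p := by
    have := h.contDiff.continuous
    have := hb.continuous
    exact ContinuousAt.sub (by fun_prop) (ContinuousAt.mul (by fun_prop) hc2)
  -- Turns a derivative value c into the linear map s ↦ s c, as the criterion with continuous
  -- partial derivatives requires.
  let sp : ℂ →L[ℝ] (ℝ →L[ℝ] ℂ) := (ContinuousLinearMap.smulRightL ℝ ℝ ℂ) 1
  have key := hasStrictFDerivAt_uncurry_coprod (𝕜 := ℝ) (u := p)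
    (f := fun t x => solution b T f H (t, x))
    (f₁ := fun t x => sp (f (t, x) -
      Complex.I * b t * solution b T (Mizohata.dx f) (deriv H) (t, x)))
    (f₂ := fun t x => sp (solution b T (Mizohata.dx f) (deriv H) (t, x)))
    (by filter_upwards [hmem] with q hq
        exact (h.hasDerivAt_solution_fst hb hpos hT0 hq).hasFDerivAt)
    (by filter_upwards [hmem] with q hq
        exact (h.hasDerivAt_solution_snd hb hpos hq).hasFDerivAt)
    (sp.continuous.continuousAt.comp hc1) (sp.continuous.continuousAt.comp hc2)
  refine key.hasFDerivAt.congr_fderiv ?_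
  ext <;> simp [solutionFDeriv, sp, Function.HasUncurry.uncurry]

/-- The differential involves only f, b and the solution for (∂_x f, H'), so the induction must
quantify over all pairs (f, H). -/
lemma IsExtension.contDiffOn_solution_nat (hb : ContDiff ℝ ∞ b)
    (hpos : ∀ t : ℝ, t ≠ 0 → 0 < t * b t) (hT0 : 0 < T) (n : ℕ) :
    ∀ {f : ℝ × ℝ → ℂ} {H : ℂ → ℂ}, IsExtension b T r f H →
      ContDiffOn ℝ n (solution b T f H) (solutionDomain b T r) := by
  induction n with
  | zero =>
    intro f H h
    exact contDiffOn_zero.2 (h.continuousOn_solution hb hpos hT0)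
  | succ n ih =>
    intro f H h
    have hd := fun p hp => h.hasFDerivAt_solution hb hpos hT0 (p := p) hp
    push_cast
    rw [contDiffOn_succ_iff_fderiv_of_isOpen (isOpen_solutionDomain hb)]
    refine ⟨fun p hp => (hd p hp).differentiableAt.differentiableWithinAt, by simp, ?_⟩
    refine ContDiffOn.congr (f := solutionFDeriv b T f H) ?_ fun p hp => (hd p hp).fderiv
    have hs := ih (h.dx hb hpos)
    have hbp : ContDiff ℝ n fun p : ℝ × ℝ => (b p.1 : ℂ) :=
      Complex.ofRealCLM.contDiff.comp ((hb.of_le (by exact_mod_cast le_top)).comp contDiff_fst)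
    have hfn : ContDiff ℝ n f := h.contDiff.of_le (by exact_mod_cast le_top)
    exact ((hfn.contDiffOn.sub ((contDiff_const.mul hbp).contDiffOn.mul hs)).smul
      contDiffOn_const).add (hs.smul contDiffOn_const)

lemma IsExtension.contDiffOn_solution (h : IsExtension b T r f H) (hb : ContDiff ℝ ∞ b)
    (hpos : ∀ t : ℝ, t ≠ 0 → 0 < t * b t) (hT0 : 0 < T) :
    ContDiffOn ℝ ∞ (solution b T f H) (solutionDomain b T r) :=
  contDiffOn_infty.2 fun n => IsExtension.contDiffOn_solution_nat hb hpos hT0 n h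

end Gluing

/-! ### From the glued function to a distribution solution; sufficiency. -/

section Existence

/-- The real power series is summed at complex arguments; its coefficients grow at most
geometrically. -/
lemma exists_holomorphic_extension {F : ℝ → ℂ} (hF : AnalyticAt ℝ F 0) :
    ∃ r > 0, ∃ H : ℂ → ℂ, DifferentiableOn ℂ H (Metric.ball 0 r) ∧
      ∀ x : ℝ, |x| < r → H x = F x := by
  obtain ⟨p, ρ, hp⟩ := hF
  obtain ⟨δ, hδ, hδρ⟩ := ENNReal.lt_iff_exists_nnreal_btwn.1 hp.r_pos
  have hδ0 : 0 < δ := by exact_mod_cast hδ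
  obtain ⟨C, -, hC⟩ := p.norm_mul_pow_le_of_lt_radius (hδρ.trans_le hp.r_le)
  have hA : (0 : ℝ) < (δ : ℝ)⁻¹ := by positivity
  obtain ⟨G, hG, hs⟩ := exists_analyticAt_hasSum (a := p.coeff) (C := C) hA fun n => by
    have := hC n
    rw [FormalMultilinearSeries.norm_apply_eq_norm_coef] at this
    rwa [inv_pow, ← div_eq_mul_inv, le_div_iff₀ (by positivity)]
  obtain ⟨r₁, hr₁, hG₁⟩ := Metric.eventually_nhds_iff_ball.1 hG.eventually_analyticAt
  -- Below r₁ the sum G is holomorphic; below δ both series converge at real x, so their sums agree.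
  refine ⟨min r₁ δ, by positivity, G, fun z hz => ?_, fun x hx => ?_⟩
  · exact (hG₁ z (Metric.ball_subset_ball (min_le_left _ _)
      hz)).differentiableAt.differentiableWithinAt
  · have hxδ : |x| < δ := hx.trans_le (min_le_right _ _)
    have h1 := hs x (by
      rw [Complex.norm_real, Real.norm_eq_abs, inv_mul_lt_iff₀ (by positivity), mul_one]
      exact hxδ)
    have h2 := hp.hasSum (y := x) (by
      rw [Metric.mem_eball, edist_zero_right]
      refine lt_trans ?_ hδρ
      rw [← ofReal_norm, Real.norm_eq_abs]
      rw [ENNReal.ofReal_lt_iff_lt_toReal (abs_nonneg _) ENNReal.coe_ne_top]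
      exact hxδ)
    rw [zero_add] at h2
    simp only [FormalMultilinearSeries.apply_eq_pow_smul_coeff, Complex.real_smul,
      Complex.ofReal_pow, mul_comm _ (p.coeff _)] at h2
    exact h1.unique h2

variable {b : ℝ → ℝ} {Ω : Opens (ℝ × ℝ)} {w : ℝ × ℝ → ℂ}

/-- The distribution given by a function. -/
def ofFun (Ω : Opens (ℝ × ℝ)) (w : ℝ × ℝ → ℂ) : 𝓓'(Ω, ℂ) :=
  (TestFunction.integralAgainstBilinCLM (ContinuousLinearMap.lsmul ℝ ℝ) volume w :
    𝓓(Ω, ℝ) →L[ℝ] ℂ)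

lemma locallyIntegrableOn_of_continuousOn (hw : ContinuousOn w Ω) :
    LocallyIntegrableOn w Ω volume :=
  hw.locallyIntegrableOn Ω.isOpen.measurableSet

lemma integrable_testFunction_smul (hw : ContinuousOn w Ω) (φ : 𝓓(Ω, ℝ)) :
    Integrable fun p => φ p • w p :=
  TestFunction.integrable_bilin (ContinuousLinearMap.lsmul ℝ ℝ)
    (locallyIntegrableOn_of_continuousOn hw) φ

lemma ofFun_apply (hw : ContinuousOn w Ω) (φ : 𝓓(Ω, ℝ)) : ofFun Ω w φ = ∫ p, φ p • w p :=
  TestFunction.integralAgainstBilinCLM_eq_integral (locallyIntegrableOn_of_continuousOn hw)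

lemma lineDeriv_ofFun_apply (hw : ContDiffOn ℝ ∞ w Ω) (φ : 𝓓(Ω, ℝ)) (v : ℝ × ℝ) :
    (∂_{v} (ofFun Ω w)) φ = ∫ p, φ p • fderiv ℝ w p v := by
  have hw' : ContinuousOn (fun p => fderiv ℝ w p v) Ω :=
    (hw.continuousOn_fderiv_of_isOpen Ω.isOpen (by simp)).clm_apply continuousOn_const
  have h1 := integrable_testFunction_smul hw.continuousOn (∂_{v} φ)
  simp_rw [lineDeriv_testFunction_apply] at h1
  rw [Distribution.lineDerivOp_apply_apply, map_neg, ofFun_apply hw.continuousOn,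
    integral_smul_fderiv_eq_neg_fderiv_smul_of_integrable h1
      (integrable_testFunction_smul hw' φ) (integrable_testFunction_smul hw.continuousOn φ)]
  · simp_rw [lineDeriv_testFunction_apply]
  · exact fun p _ => (φ.contDiff.differentiable (by simp)).differentiableAt
  · exact fun p hp => (hw.contDiffAt (Ω.isOpen.mem_nhds (φ.tsupport_subset hp))).differentiableAt
      (by simp)

lemma isSolution_ofFun (hb : ContDiff ℝ ∞ b) {f : ℝ × ℝ → ℂ} (hw : ContDiffOn ℝ ∞ w Ω)
    (h : ∀ p ∈ Ω, fderiv ℝ w p (1, 0) + Complex.I * b p.1 * fderiv ℝ w p (0, 1) = f p) :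
    IsSolution b hb f (ofFun Ω w) := by
  intro φ
  have hw' : ∀ v, ContinuousOn (fun p => fderiv ℝ w p v) Ω := fun v =>
    (hw.continuousOn_fderiv_of_isOpen Ω.isOpen (by simp)).clm_apply continuousOn_const
  rw [opM, lineDeriv_ofFun_apply hw, lineDeriv_ofFun_apply hw, ← integral_const_mul, ← integral_add
    (integrable_testFunction_smul (hw' _) φ) ((integrable_testFunction_smul (hw' _) _).const_mul _)]
  refine integral_congr_ae (ae_of_all _ fun p => ?_)
  change φ p • _ + Complex.I * ((b p.1 * φ p) • _) = _
  simp only [Complex.real_smul]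
  by_cases hp : p ∈ Ω
  · rw [← h p hp]
    push_cast
    ring
  · have : φ p = 0 := image_eq_zero_of_notMem_tsupport fun h' => hp (φ.tsupport_subset h')
    simp [this]

theorem exists_smooth_solution (hb : ContDiff ℝ ∞ b) (hpos : ∀ t : ℝ, t ≠ 0 → 0 < t * b t)
    {f : ℝ × ℝ → ℂ} (hf : ContDiff ℝ ∞ f) (hfc : HasCompactSupport f)
    (hK : AnalyticAt ℝ (Kf b f) 0) :
    ∃ Ω : Opens (ℝ × ℝ), (0, 0) ∈ Ω ∧ ∃ u : 𝓓'(Ω, ℂ), IsSolution b hb f u ∧ IsSmooth u := by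
  obtain ⟨r, hr, H, hH, hHK⟩ := exists_holomorphic_extension hK
  obtain ⟨T, hT0, hT⟩ := exists_time_bound hfc
  have hE : IsExtension b T r f H := ⟨hf, hfc, hT, hH, hHK⟩
  let Ω : Opens (ℝ × ℝ) := ⟨solutionDomain b T r, isOpen_solutionDomain hb⟩
  have hs : ContDiffOn ℝ ∞ (solution b T f H) Ω := hE.contDiffOn_solution hb hpos hT0
  refine ⟨Ω, ⟨by simpa using hT0, by simpa [firstIntegral] using hr⟩,
    ofFun Ω (solution b T f H), isSolution_ofFun hb hs fun p hp => ?_,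
    solution b T f H, hs, fun φ => ?_⟩
  · rw [(hE.hasFDerivAt_solution hb hpos hT0 hp).fderiv]
    simp [solutionFDeriv]
  · simp [ofFun_apply hs.continuousOn]

end Existence

end Mizohata

end

theorem theorem2 (b : ℝ → ℝ) (hb : ContDiff ℝ ∞ b) (hpos : ∀ t : ℝ, t ≠ 0 → 0 < t * b t)
    (f : ℝ × ℝ → ℂ) (hf : ContDiff ℝ ∞ f) (hfc : HasCompactSupport f) :
    ((∃ Ω : TopologicalSpace.Opens (ℝ × ℝ), (0, 0) ∈ Ω ∧
        ∃ u : 𝓓'(Ω, ℂ), Mizohata.IsSolution b hb f u) ↔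
      AnalyticAt ℝ (Mizohata.Kf b f) 0) ∧
    (AnalyticAt ℝ (Mizohata.Kf b f) 0 →
      ∃ Ω : TopologicalSpace.Opens (ℝ × ℝ), (0, 0) ∈ Ω ∧
        ∃ u : 𝓓'(Ω, ℂ), Mizohata.IsSolution b hb f u ∧ Mizohata.IsSmooth u) := by
  refine ⟨⟨?_, fun h => ?_⟩, Mizohata.exists_smooth_solution hb hpos hf hfc⟩
  · rintro ⟨Ω, h0, u, hu⟩
    exact Mizohata.analyticAt_Kf_of_isSolution hb hpos hf hfc h0 hu
  · obtain ⟨Ω, h0, u, hu, -⟩ := Mizohata.exists_smooth_solution hb hpos hf hfc h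
    exact ⟨Ω, h0, u, hu⟩
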